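/- Let $\Omega=(a,b)$ be a bounded interval, $T>0$, $0<\gamma<1$, $1<\alpha<2$, $K_{\gamma,\alpha}>0$. Write $(u,v)=\int_a^b u\,\overline{v}\,dx$ and $\|u\|^2=(u,u)$. Let $U:\Omega\to\mathbb R$ be integrable and $p\in\mathbb C$ with $\operatorname{Re}(pU(x))\ge 0$ on $\Omega$ (for example $p\geq 0$ and $U\ge 0$). Define the Caputo fractional substantial derivative $$ {}^SD_{*,t}^{\gamma}G(x,t)=\frac{e^{-pU(x)t}}{\Gamma(1-\gamma)}\int_0^t (t-s)^{-\gamma}\,e^{pU(x)s}\Big(\frac{\partial}{\partial s}+pU(x)\Big)G(x,s)\,ds, $$ and the bilinear (for complex-valued functions: sesquilinear) form $$ B(u,v)=\frac{\big({}_aD_x^{\alpha/2}u,\,{}_xD_b^{\alpha/2}v\big)+\big({}_xD_b^{\alpha/2}u,\,{}_aD_x^{\alpha/2}v\big)}{2\cos(\alpha\pi/2)}, $$ where, for $0<\sigma<1$, ${}_aD_x^{\sigma}u(x)=\frac1{\Gamma(1-\sigma)}\frac{d}{dx}\int_a^x (x-\xi)^{-\sigma}u(\xi)\,d\xi$ and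 ${}_xD_b^{\sigma}u(x)=\frac{-1}{\Gamma(1-\sigma)}\frac{d}{dx}\int_x^b(\xi-x)^{-\sigma}u(\xi)\,d\xi$ are the left and right Riemann–Liouville derivatives. For integers $d\ge 2$, $J\ge 0$ let $t_1\le t_2\le\cdots$ be the knots $0,\dots,0$ ($d$ times), $2^{-J},2\cdot2^{-J},\dots,1-2^{-J}$, $1,\dots,1$ ($d$ times), and let $S_J$ be the complex span of the B-splines $$\phi_{J,k}(x)=2^{J/2}(t_{k+d+1}-t_{k+1})\,[t_{k+1},\dots,t_{k+d+1}]_t\,\big(\max\{0,t-x\}\big)^{d-1},\qquad 1\le k\le 2^J+d-3,$$ transported from $(0,1)$ to $\Omega$ by the affine map, where $[\,\cdot\,]_t$ is the divided difference in $t$. Consider the Galerkin space semi-discrete scheme (model II): $G_J(\cdot,t)\in S_J$ for $0\le t\le T$, the coefficients of $G_J(\cdot,t)$ in the functions $\phi_{J,k}$ are absolutely continuous on $[0,T]$, and for a.e. $t\in(0,T)$ $$\big({}^SD_{*,t}^{\gamma}G_J,\,v\big)+K_{\gamma,\alpha}B(G_J,v)=(f,v)\qquad\forall v\in S_J,$$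 where $f\in L^2((0,T)\times\Omega)$. The initial value $G_J(0)\in S_J$ is a stable approximation of the initial datum $g\in L^2(\Omega)$, i.e. $\|G_J(0)\|\le M\|g\|$ with a fixed constant $M$ ($M=1$ if $G_J(0)=g$ or if $G_J(0)$ is the $L^2$-projection of $g$). **Theorem.** There is a constant $C>0$, depending only on $a,b,\alpha,\gamma,K_{\gamma,\alpha},T,M$ (and not on $d,J,p,U,g,f,G_J,t$), such that for every such $G_J$ and every $t\in[0,T]$ the left-hand integrand below is integrable on $(0,t)$ and $$\int_0^t\Big(\|G_J\|^2+K_{\gamma,\alpha}\,\operatorname{Re}B(G_J,G_J)\Big)\,ds\;\le\; C\Big(\|g\|^2+\int_0^t\|f\|^2\,ds\Big).$$ (The real part is superfluous, since $B(u,u)$ is real.) -/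

import Mathlib

open MeasureTheory Set

noncomputable section

namespace FeynmanKac

/-! ### `L²` inner product and norm on `Ω = (a, b)` -/

/-- The `L²(a, b)` inner product `(u, v) = ∫_a^b u(x) conj(v(x)) dx` (linear in `u`). -/
def l2Inner (a b : ℝ) (u v : ℝ → ℂ) : ℂ :=
  ∫ x in Ioo a b, u x * (starRingEnd ℂ) (v x)

/-- The `L²(a, b)` norm `‖u‖ = (∫_a^b |u(x)|² dx)^{1/2}`. -/
def l2Norm (a b : ℝ) (u : ℝ → ℂ) : ℝ :=
  Real.sqrt (∫ x in Ioo a b, ‖u x‖ ^ 2)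

/-! ### Fractional derivatives -/

/-- Left Riemann–Liouville derivative of order `s ∈ (0, 1)` with base point `a`:
`1/Γ(1-s) · d/dx ∫_a^x (x-ξ)^{-s} u(ξ) dξ`. -/
def leftRL (a s : ℝ) (u : ℝ → ℂ) (x : ℝ) : ℂ :=
  ((Real.Gamma (1 - s))⁻¹ : ℝ) • deriv (fun y : ℝ => ∫ ξ in a..y, ((y - ξ) ^ (-s) : ℝ) • u ξ) x

/-- Right Riemann–Liouville derivative of order `s ∈ (0, 1)` with base point `b`:
`-1/Γ(1-s) · d/dx ∫_x^b (ξ-x)^{-s} u(ξ) dξ`. -/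
def rightRL (b s : ℝ) (u : ℝ → ℂ) (x : ℝ) : ℂ :=
  (-(Real.Gamma (1 - s))⁻¹ : ℝ) • deriv (fun y : ℝ => ∫ ξ in y..b, ((ξ - y) ^ (-s) : ℝ) • u ξ) x

/-- The form `B(u, v)` of the negative Riesz derivative of order `α` on `(a, b)`:
the sum of the two mixed products of left and right Riemann–Liouville derivatives of order `α/2`,
divided by `2 cos(απ/2)`. -/
def rieszForm (a b α : ℝ) (u v : ℝ → ℂ) : ℂ :=
  (l2Inner a b (leftRL a (α / 2) u) (rightRL b (α / 2) v) +
      l2Inner a b (rightRL b (α / 2) u) (leftRL a (α / 2) v)) /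
    ((2 * Real.cos (α * Real.pi / 2) : ℝ) : ℂ)

/-- The Caputo fractional substantial derivative of order `γ ∈ (0, 1)` of `G(t, x)` in `t`:
`e^{-pU(x)t} · 1/Γ(1-γ) ∫_0^t (t-s)^{-γ} e^{pU(x)s} (∂_s + pU(x)) G(s, x) ds`. -/
def caputoSubstantial (γ : ℝ) (p : ℂ) (U : ℝ → ℝ) (G : ℝ → ℝ → ℂ) (t x : ℝ) : ℂ :=
  Complex.exp (-(p * (U x : ℂ) * (t : ℂ))) *
    (((Real.Gamma (1 - γ))⁻¹ : ℝ) •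
      ∫ s in (0 : ℝ)..t, ((t - s) ^ (-γ) : ℝ) •
        (Complex.exp (p * (U x : ℂ) * (s : ℂ)) *
          (deriv (fun τ : ℝ => G τ x) s + p * (U x : ℂ) * G s x)))

/-! ### B-spline multiresolution spaces -/

/-- Divided difference `[τ_m, …, τ_{m+n}] f` for a nondecreasing sequence of points `τ`;
if all the points coincide it is `f⁽ⁿ⁾(τ_m) / n!`. -/
def dividedDiff (f : ℝ → ℝ) (τ : ℕ → ℝ) : ℕ → ℕ → ℝ
  | 0, m => f (τ m)
  | n + 1, m =>
      if τ (m + n + 1) = τ m then iteratedDeriv (n + 1) f (τ m) / (Nat.factorial (n + 1) : ℝ)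
      else (dividedDiff f τ n (m + 1) - dividedDiff f τ n m) / (τ (m + n + 1) - τ m)

/-- The Schoenberg knots of order `d` and level `j` on `[0, 1]`, numbered from `1`:
`0` (`d` times), `2^{-j}, …, 1 - 2^{-j}`, `1` (`d` times). -/
def knot (d j i : ℕ) : ℝ :=
  max 0 (min 1 (((i : ℝ) - (d : ℝ)) / 2 ^ j))

/-- The scaling function on `[0, 1]`:
`φ_{j,k}(x) = 2^{j/2} (t_{k+d+1} - t_{k+1}) [t_{k+1}, …, t_{k+d+1}] (t - x)_+^{d-1}`. -/
def bspline (d j k : ℕ) (x : ℝ) : ℝ :=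
  (2 : ℝ) ^ ((j : ℝ) / 2) * (knot d j (k + d + 1) - knot d j (k + 1)) *
    dividedDiff (fun t : ℝ => (max 0 (t - x)) ^ (d - 1)) (knot d j) d (k + 1)

/-- The scaling function transported to `Ω = (a, b)` by the affine map, with complex values. -/
def scaling (a b : ℝ) (d j k : ℕ) (x : ℝ) : ℂ :=
  ((bspline d j k ((x - a) / (b - a)) : ℝ) : ℂ)

/-- The index set `{1, …, 2^j + d - 3}` of the scaling functions of order `d` and level `j`. -/
def scalingIndex (d j : ℕ) : Finset ℕ := Finset.Icc 1 (2 ^ j + d - 3)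

/-- The (complex) trial and test space, the span of the scaling functions of level `J`. -/
def splineSpace (a b : ℝ) (d J : ℕ) : Submodule ℂ (ℝ → ℂ) :=
  Submodule.span ℂ ((fun k => scaling a b d J k) '' (scalingIndex d J : Set ℕ))

/-! ### The space semi-discrete scheme -/

/-- `G : [0, T] → S_J` solves the Galerkin space semi-discretization of
`ˢD_{*,t}^γ G = K ∇^α G + f`: its coefficients in the scaling functions are absolutely continuous
on `[0, T]`, and `(ˢD_{*,t}^γ G(t), v) + K B(G(t), v) = (f(t), v)` for all `v ∈ S_J` and almost
every `t ∈ (0, T)`. -/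
structure IsSemiDiscreteSolution (a b α γ K T : ℝ) (d J : ℕ) (p : ℂ) (U : ℝ → ℝ)
    (f : ℝ → ℝ → ℂ) (G : ℝ → ℝ → ℂ) : Prop where
  trial : ∃ c : ℕ → ℝ → ℂ,
    (∀ k ∈ scalingIndex d J, AbsolutelyContinuousOnInterval (c k) 0 T) ∧
    ∀ t ∈ Icc (0 : ℝ) T, ∀ x : ℝ, G t x = ∑ k ∈ scalingIndex d J, c k t * scaling a b d J k x
  weak : ∀ᵐ t ∂(volume.restrict (Ioo (0 : ℝ) T)), ∀ v ∈ splineSpace a b d J,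
    l2Inner a b (caputoSubstantial γ p U G t) v + (K : ℂ) * rieszForm a b α (G t) v =
      l2Inner a b (f t) v

end FeynmanKac

end

/-!
The scheme is tested with `v = G(t)` and real parts are taken.

In time, put `q = p U(x)` and `z(s) = e^{qs} y(s)`: the substantial derivative of `y` is the Caputo
derivative of `z` times `e^{-qt}`. Since the kernel `(t - s)^{-γ}` increases in `s`, integrating
`⟪z(t) - z(s), z'(s)⟫ = -½ d/ds |z(t) - z(s)|²` by parts shows that `⟪z(t), ∂^γ z(t)⟫` dominates
the Caputo integral of `½ (|z|²)'`. Integrating this against the weight `e^{-rt}`, `r = 2 Re q`, and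
exchanging the order of integration replaces the kernel by `∫_s^τ e^{-rt} (t - s)^{-γ} dt`, whose
derivative in `s` is at most `-(τ - s)^{-γ} e^{-rs}`. A second integration by parts bounds
`∫_0^τ |y|²` by the initial value and `∫_0^τ Re(D^γ y · conj y)`, with constants independent of `q`.

In space, splines are Lipschitz and vanish at the end points, so their Riemann–Liouville
derivatives of order `α/2` are fractional integrals of order `1 - α/2` of `u'`. Composing a left and
a right kernel of that order gives a multiple of `(ξ - η)_+^{1-α}`, so `B(u, u)` is governed by the
real part of the form of this kernel, i.e. by the kernel `|ξ - η|^{1-α}`. That kernel is positive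
semidefinite, being a multiple of `∫ (ξ - x)_+^{-σ} (η - x)_+^{-σ} dx` over the whole line with
`σ = α/2`, and `Re B(u, u)` inherits the sign of `-1/cos(απ/2) > 0`. Finally `(f, G)` is absorbed
by the Young inequality.
-/

namespace FeynmanKac

open Filter Topology
open scoped InnerProductSpace ComplexConjugate

section SingularKernel

/-- The weakly singular kernel `u ↦ u^{-s}`, extended by `0` to `u ≤ 0` so that one-sided
fractional integrals over an interval become integrals over the whole interval. -/
noncomputable def singularKernel (s u : ℝ) : ℝ :=
  (Ioi (0 : ℝ)).indicator (fun u => u ^ (-s)) u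

lemma singularKernel_of_pos {s u : ℝ} (hu : 0 < u) : singularKernel s u = u ^ (-s) :=
  indicator_of_mem hu _

lemma singularKernel_of_nonpos {s u : ℝ} (hu : u ≤ 0) : singularKernel s u = 0 :=
  indicator_of_notMem (not_lt.2 hu) _

lemma singularKernel_nonneg (s u : ℝ) : 0 ≤ singularKernel s u :=
  indicator_nonneg (fun _ hx => Real.rpow_nonneg (le_of_lt hx) _) _

@[fun_prop]
lemma measurable_singularKernel (s : ℝ) : Measurable (singularKernel s) :=
  (by fun_prop : Measurable fun u : ℝ => u ^ (-s)).indicator measurableSet_Ioi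

variable {E : Type*} [NormedAddCommGroup E] [NormedSpace ℝ E] {s : ℝ}

lemma integrableOn_singularKernel (hs : s < 1) (c d : ℝ) :
    IntegrableOn (singularKernel s) (Ioc c d) := by
  have hpow : IntegrableOn (fun u : ℝ => u ^ (-s)) (Ioc 0 (max d 0)) :=
    (intervalIntegrable_iff_integrableOn_Ioc_of_le (le_max_right _ _)).1
      (intervalIntegral.intervalIntegrable_rpow' (by linarith))
  have hind : Integrable ((Ioc 0 (max d 0)).indicator fun u : ℝ => u ^ (-s)) :=
    hpow.integrable_indicator measurableSet_Ioc
  refine (hind.integrableOn (s := Ioc c d)).congr_fun (fun u hu => ?_) measurableSet_Ioc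
  by_cases hu0 : 0 < u
  · simp [singularKernel, hu0, hu.2]
  · simp [singularKernel, hu0]

lemma integrable_singularKernel_sub_smul (hs : s < 1) {a b : ℝ} {g : ℝ → E}
    (hg : IntegrableOn g (Ioc a b)) :
    Integrable (fun p : ℝ × ℝ => singularKernel s (p.1 - p.2) • g p.2)
      ((volume.restrict (Ioc a b)).prod (volume.restrict (Ioc a b))) := by
  have hk : Integrable ((Ioc 0 (b - a)).indicator (singularKernel s)) :=
    (integrableOn_singularKernel hs 0 (b - a)).integrable_indicator measurableSet_Ioc
  have hconv := (hg.convolution_integrand (ContinuousLinearMap.lsmul ℝ ℝ).flip hk).mono_measure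
    (Measure.prod_mono (Measure.restrict_le_self (μ := volume) (s := Ioc a b)) le_rfl)
  rw [Measure.prod_restrict] at hconv ⊢
  refine hconv.congr ?_
  filter_upwards [ae_restrict_mem (measurableSet_Ioc.prod measurableSet_Ioc)] with p hp
  simp only [ContinuousLinearMap.flip_apply, ContinuousLinearMap.lsmul_apply]
  congr 1
  by_cases h0 : 0 < p.1 - p.2
  · rw [indicator_of_mem]
    exact ⟨h0, by linarith [hp.1.2, hp.2.1]⟩
  · rw [singularKernel_of_nonpos (not_lt.1 h0), indicator_of_notMem]
    exact fun h => h0 h.1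

lemma setIntegral_singularKernel_sub_smul (s : ℝ) {a b x : ℝ} (hx : x ∈ Icc a b) (g : ℝ → E) :
    ∫ ξ in Ioc a b, singularKernel s (x - ξ) • g ξ = ∫ ξ in a..x, ((x - ξ) ^ (-s) : ℝ) • g ξ := by
  have hI : Ioo a x = Ioc a b ∩ Iio x := by
    ext ξ
    exact ⟨fun h => ⟨⟨h.1, (h.2.trans_le hx.2).le⟩, h.2⟩, fun h => ⟨h.1.1, h.2⟩⟩
  rw [intervalIntegral.integral_of_le hx.1, integral_Ioc_eq_integral_Ioo (x := a) (y := x), hI,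
    ← setIntegral_indicator measurableSet_Iio]
  refine integral_congr_ae (Eventually.of_forall fun ξ => ?_)
  by_cases h : ξ < x
  · simp [h, singularKernel_of_pos]
  · simp [h, singularKernel_of_nonpos (sub_nonpos.2 (not_lt.1 h))]

lemma integrableOn_integral_rpow_sub_smul (hs : s < 1) {a b : ℝ} {g : ℝ → E}
    (hg : IntegrableOn g (Ioc a b)) :
    IntegrableOn (fun x => ∫ ξ in a..x, ((x - ξ) ^ (-s) : ℝ) • g ξ) (Ioc a b) :=
  (integrable_singularKernel_sub_smul hs hg).integral_prod_left.congr <| by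
    filter_upwards [ae_restrict_mem measurableSet_Ioc] with x hx
    exact setIntegral_singularKernel_sub_smul s (Ioc_subset_Icc_self hx) g

lemma ae_intervalIntegrable_rpow_sub_smul (hs : s < 1) {a b : ℝ} {g : ℝ → E}
    (hg : IntegrableOn g (Ioc a b)) :
    ∀ᵐ x ∂(volume.restrict (Ioc a b)),
      IntervalIntegrable (fun ξ => ((x - ξ) ^ (-s) : ℝ) • g ξ) volume a x := by
  filter_upwards [(integrable_singularKernel_sub_smul hs hg).prod_right_ae,
    ae_restrict_mem measurableSet_Ioc] with x hx hxm
  rw [intervalIntegrable_iff_integrableOn_Ioo_of_le hxm.1.le]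
  have hsub : IntegrableOn (fun ξ => singularKernel s (x - ξ) • g ξ) (Ioo a x) :=
    IntegrableOn.mono_set hx (Ioo_subset_Ioc_self.trans (Ioc_subset_Ioc_right hxm.2))
  exact hsub.congr_fun (fun ξ hξ => by simp only [singularKernel_of_pos (sub_pos.2 hξ.2)])
    measurableSet_Ioo

lemma intervalIntegrable_rpow_sub_left (hs : s < 1) (a b : ℝ) :
    IntervalIntegrable (fun ξ : ℝ => (b - ξ) ^ (-s)) volume a b := by
  simpa using (intervalIntegral.intervalIntegrable_rpow' (a := b - a) (b := 0)
    (r := -s) (by linarith)).comp_sub_left b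

end SingularKernel

section AbsolutelyContinuous

variable {E : Type*} [NormedAddCommGroup E] {a b : ℝ} {f : ℝ → E}

lemma absolutelyContinuousOnInterval_lipschitzWith_comp {X Y : Type*} [PseudoMetricSpace X]
    [PseudoMetricSpace Y] {K : NNReal} {φ : X → Y} {g : ℝ → X} (hφ : LipschitzWith K φ)
    (hg : AbsolutelyContinuousOnInterval g a b) :
    AbsolutelyContinuousOnInterval (fun t => φ (g t)) a b := by
  refine squeeze_zero (fun _ => Finset.sum_nonneg fun _ _ => dist_nonneg) (fun I => ?_)
    (by simpa using Tendsto.const_mul (K : ℝ) hg)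
  rw [Finset.mul_sum]
  exact Finset.sum_le_sum fun i _ => hφ.dist_le_mul _ _

lemma absolutelyContinuousOnInterval_const {X : Type*} [PseudoMetricSpace X] (c : X) (a b : ℝ) :
    AbsolutelyContinuousOnInterval (fun _ => c) a b :=
  (LipschitzWith.const c).lipschitzOnWith.absolutelyContinuousOnInterval

lemma absolutelyContinuousOnInterval_congr {X : Type*} [PseudoMetricSpace X] {f g : ℝ → X}
    {a b : ℝ} (hf : AbsolutelyContinuousOnInterval f a b) (h : EqOn f g (uIcc a b)) :
    AbsolutelyContinuousOnInterval g a b := by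
  refine Tendsto.congr' (eventually_inf_principal.2 (Eventually.of_forall fun I hI => ?_)) hf
  exact Finset.sum_congr rfl fun i hi => by rw [h (hI.1 i hi).1, h (hI.1 i hi).2]

lemma absolutelyContinuousOnInterval_sum {E ι : Type*} [SeminormedAddCommGroup E] {I : Finset ι}
    {f : ι → ℝ → E} {a b : ℝ} (hf : ∀ i ∈ I, AbsolutelyContinuousOnInterval (f i) a b) :
    AbsolutelyContinuousOnInterval (∑ i ∈ I, f i) a b :=
  Finset.sum_induction f (AbsolutelyContinuousOnInterval · a b) (fun _ _ => .add)
    (absolutelyContinuousOnInterval_const 0 a b) hf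

lemma absolutelyContinuousOnInterval_reflect {X : Type*} [PseudoMetricSpace X] {u : ℝ → X}
    {a b : ℝ} (hu : AbsolutelyContinuousOnInterval u a b) :
    AbsolutelyContinuousOnInterval (fun x => u (a + b - x)) a b := by
  rw [absolutelyContinuousOnInterval_iff] at hu ⊢
  intro ε hε
  obtain ⟨δ, hδ, h⟩ := hu ε hε
  refine ⟨δ, hδ, fun E hE hlen =>
    h (E.1, fun i => (a + b - (E.2 i).1, a + b - (E.2 i).2)) ⟨fun i hi => ?_, ?_⟩ ?_⟩
  · have hmem := hE.1 i hi
    simp only [mem_uIcc] at hmem ⊢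
    grind
  · intro i hi j hj hij
    have hdisj := hE.2 hi hj hij
    simp only [Function.onFun, uIoc, Ioc_disjoint_Ioc] at hdisj ⊢
    grind
  · simpa only [dist_sub_left] using hlen

lemma memLp_top_of_absolutelyContinuousOnInterval {E : Type*} [NormedAddCommGroup E] {f : ℝ → E}
    {a b : ℝ} (hab : a ≤ b) (hf : AbsolutelyContinuousOnInterval f a b) :
    MemLp f ⊤ (volume.restrict (Ioc a b)) := by
  obtain ⟨C, hC⟩ := hf.exists_bound
  have hcont := hf.continuousOn
  rw [uIcc_of_le hab] at hC hcont
  refine memLp_top_of_bound ((hcont.mono Ioc_subset_Icc_self).aestronglyMeasurable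
    measurableSet_Ioc) C ?_
  filter_upwards [ae_restrict_mem measurableSet_Ioc] with x hx using hC x (Ioc_subset_Icc_self hx)

lemma absolutelyContinuousOnInterval_norm_sub_sq (hf : AbsolutelyContinuousOnInterval f a b)
    (c : E) : AbsolutelyContinuousOnInterval (fun s => ‖f s - c‖ ^ 2) a b := by
  have hnorm : AbsolutelyContinuousOnInterval (fun s => ‖f s - c‖) a b :=
    absolutelyContinuousOnInterval_lipschitzWith_comp lipschitzWith_one_norm
      (hf.fun_sub (absolutelyContinuousOnInterval_const c a b))
  simpa only [sq] using hnorm.fun_mul hnorm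

section FiniteDimensional

variable [NormedSpace ℝ E] [FiniteDimensional ℝ E]

lemma ae_differentiableAt_of_absolutelyContinuousOnInterval
    (hf : AbsolutelyContinuousOnInterval f a b) :
    ∀ᵐ x, x ∈ uIcc a b → DifferentiableAt ℝ f x :=
  hf.boundedVariationOn.ae_differentiableAt_of_mem_uIcc

lemma ae_deriv_clm_comp (L : E →L[ℝ] ℝ) (hf : AbsolutelyContinuousOnInterval f a b) :
    ∀ᵐ x, x ∈ uIoc a b → deriv (fun t => L (f t)) x = L (deriv f x) := by
  filter_upwards [ae_differentiableAt_of_absolutelyContinuousOnInterval hf] with x hx hxI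
  exact (L.hasFDerivAt.comp_hasDerivAt x (hx (uIoc_subset_uIcc hxI)).hasDerivAt).deriv

lemma intervalIntegrable_deriv_of_absolutelyContinuousOnInterval
    (hf : AbsolutelyContinuousOnInterval f a b) : IntervalIntegrable (deriv f) volume a b := by
  let e := Module.finBasis ℝ E
  let L i : E →L[ℝ] ℝ := (e.coord i).toContinuousLinearMap
  have hcoord i : IntervalIntegrable (fun x => L i (deriv f x)) volume a b :=
    (absolutelyContinuousOnInterval_lipschitzWith_comp
      (L i).lipschitz hf).intervalIntegrable_deriv.congr_ae
      ((ae_restrict_iff' measurableSet_uIoc).2 (ae_deriv_clm_comp (L i) hf))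
  have hsum : deriv f = ∑ i, fun x => L i (deriv f x) • e i :=
    funext fun x => by rw [Finset.sum_apply]; exact (e.sum_repr (deriv f x)).symm
  rw [hsum]
  exact IntervalIntegrable.sum _ fun i _ =>
    ⟨Integrable.smul_const (hcoord i).1 (e i), Integrable.smul_const (hcoord i).2 (e i)⟩

lemma integral_deriv_of_absolutelyContinuousOnInterval
    (hf : AbsolutelyContinuousOnInterval f a b) : ∫ x in a..b, deriv f x = f b - f a := by
  let e := Module.finBasis ℝ E
  refine e.ext_elem fun i => ?_
  let L : E →L[ℝ] ℝ := (e.coord i).toContinuousLinearMap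
  change L _ = L _
  rw [map_sub, ← (absolutelyContinuousOnInterval_lipschitzWith_comp
      L.lipschitz hf).integral_deriv_eq_sub,
    ← L.intervalIntegral_comp_comm (intervalIntegrable_deriv_of_absolutelyContinuousOnInterval hf)]
  refine intervalIntegral.integral_congr_ae ?_
  filter_upwards [ae_deriv_clm_comp L hf] with x hx hxI using (hx hxI).symm

end FiniteDimensional

end AbsolutelyContinuous

section RegularizedKernel

variable {E : Type*} [NormedAddCommGroup E] [NormedSpace ℝ E] {a b γ : ℝ}

lemma tendsto_integral_rpow_sub_add_smul (hγ : 0 ≤ γ) (hab : a ≤ b) {g : ℝ → E}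
    (hg : AEStronglyMeasurable g (volume.restrict (uIoc a b)))
    (hi : IntervalIntegrable (fun s => ((b - s) ^ (-γ) : ℝ) • g s) volume a b) :
    Tendsto (fun ε : ℝ => ∫ s in a..b, ((b - s + ε) ^ (-γ) : ℝ) • g s) (𝓝[>] 0)
      (𝓝 (∫ s in a..b, ((b - s) ^ (-γ) : ℝ) • g s)) := by
  have hne : ∀ᵐ s : ℝ, s ∈ uIoc a b → 0 < b - s := by
    filter_upwards [show ∀ᵐ s : ℝ, s ≠ b by simp [ae_iff, measure_singleton]] with s hs hsI
    rw [uIoc_of_le hab] at hsI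
    exact sub_pos.2 (lt_of_le_of_ne hsI.2 hs)
  refine intervalIntegral.tendsto_integral_filter_of_dominated_convergence
    (fun s => ‖((b - s) ^ (-γ) : ℝ) • g s‖) (Eventually.of_forall fun ε => ?_) ?_ hi.norm ?_
  · exact (by fun_prop : Measurable fun s : ℝ => (b - s + ε) ^ (-γ)).aestronglyMeasurable.smul hg
  · filter_upwards [self_mem_nhdsWithin] with ε (hε : 0 < ε)
    filter_upwards [hne] with s hs hsI
    have hpos := hs hsI
    rw [norm_smul, norm_smul, Real.norm_of_nonneg (by positivity),
      Real.norm_of_nonneg (by positivity)]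
    gcongr ?_ * _
    exact Real.rpow_le_rpow_of_nonpos hpos (by linarith) (by linarith)
  · filter_upwards [hne] with s hs hsI
    have hcont : ContinuousAt (fun ε : ℝ => (b - s + ε) ^ (-γ)) 0 :=
      ContinuousAt.rpow_const (by fun_prop) (Or.inl (by simpa using (hs hsI).ne'))
    simpa using (hcont.tendsto.mono_left nhdsWithin_le_nhds).smul_const (g s)

lemma absolutelyContinuousOnInterval_rpow_sub_add {ε : ℝ} (hε : 0 < ε) (hab : a ≤ b) :
    AbsolutelyContinuousOnInterval (fun s : ℝ => (b - s + ε) ^ (-γ)) a b := by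
  refine ContDiffOn.absolutelyContinuousOnInterval fun s hs => ?_
  rw [uIcc_of_le hab] at hs
  exact (ContDiffAt.rpow_const_of_ne (f := fun s : ℝ => b - s + ε) (n := 1) (by fun_prop)
    (by linarith [hs.2])).contDiffWithinAt

end RegularizedKernel

section CaputoPositivity

variable {E : Type*} [NormedAddCommGroup E] [InnerProductSpace ℝ E] {a b γ r τ : ℝ} {f : ℝ → E}

lemma intervalIntegrable_inner_of_continuousOn {g : ℝ → E} (hf : ContinuousOn f (uIcc a b))
    (hg : IntervalIntegrable g volume a b) :
    IntervalIntegrable (fun s => ⟪f s, g s⟫_ℝ) volume a b := by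
  obtain ⟨C, hC⟩ := isCompact_uIcc.exists_bound_of_continuousOn hf
  rw [intervalIntegrable_iff] at hg ⊢
  refine (hg.norm.const_mul C).mono'
    (((hf.mono uIoc_subset_uIcc).aestronglyMeasurable measurableSet_uIoc).inner hg.1) ?_
  filter_upwards [ae_restrict_mem measurableSet_uIoc] with s hs
  exact (norm_inner_le_norm _ _).trans
    (mul_le_mul_of_nonneg_right (hC s (uIoc_subset_uIcc hs)) (norm_nonneg _))

variable [FiniteDimensional ℝ E]

lemma integral_mul_inner_sub_deriv {k : ℝ → ℝ} (hk : AbsolutelyContinuousOnInterval k a b)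
    (hf : AbsolutelyContinuousOnInterval f a b) (c : E) :
    ∫ s in a..b, k s * ⟪f s - c, deriv f s⟫_ℝ =
      (k b * ‖f b - c‖ ^ 2 - k a * ‖f a - c‖ ^ 2 - ∫ s in a..b, deriv k s * ‖f s - c‖ ^ 2) / 2 := by
  rw [← hk.integral_mul_deriv_eq_deriv_mul (absolutelyContinuousOnInterval_norm_sub_sq hf c),
    ← intervalIntegral.integral_div]
  refine intervalIntegral.integral_congr_ae ?_
  filter_upwards [ae_differentiableAt_of_absolutelyContinuousOnInterval hf] with s hs hsI
  rw [((hs (uIoc_subset_uIcc hsI)).hasDerivAt.sub_const c).norm_sq.deriv]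
  ring

lemma integral_mul_inner_sub_right_deriv_nonpos (hab : a ≤ b) {k : ℝ → ℝ}
    (hk : AbsolutelyContinuousOnInterval k a b) (hmono : MonotoneOn k (Icc a b)) (hka : 0 ≤ k a)
    (hf : AbsolutelyContinuousOnInterval f a b) :
    ∫ s in a..b, k s * ⟪f s - f b, deriv f s⟫_ℝ ≤ 0 := by
  have hderiv : 0 ≤ ∫ s in a..b, deriv k s * ‖f s - f b‖ ^ 2 := by
    rw [intervalIntegral.integral_of_le hab, integral_Ioc_eq_integral_Ioo]
    refine setIntegral_nonneg measurableSet_Ioo fun s hs => mul_nonneg ?_ (sq_nonneg _)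
    rw [← derivWithin_of_mem_nhds (Icc_mem_nhds hs.1 hs.2)]
    exact hmono.derivWithin_nonneg
  rw [integral_mul_inner_sub_deriv hk hf, sub_self, norm_zero]
  linarith [mul_nonneg hka (sq_nonneg ‖f a - f b‖)]

lemma integral_rpow_sub_mul_inner_sub_right_nonpos (hγ : 0 ≤ γ) (hab : a ≤ b)
    (hf : AbsolutelyContinuousOnInterval f a b)
    (hi : IntervalIntegrable (fun s => ((b - s) ^ (-γ) : ℝ) • deriv f s) volume a b) :
    ∫ s in a..b, (b - s) ^ (-γ) * ⟪f s - f b, deriv f s⟫_ℝ ≤ 0 := by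
  have hcont : ContinuousOn (fun s => f s - f b) (uIcc a b) :=
    hf.continuousOn.sub continuousOn_const
  have hint : IntervalIntegrable (fun s => ((b - s) ^ (-γ) : ℝ) • ⟪f s - f b, deriv f s⟫_ℝ)
      volume a b := by
    simpa only [real_inner_smul_right, smul_eq_mul] using
      intervalIntegrable_inner_of_continuousOn hcont hi
  have hmeas : AEStronglyMeasurable (fun s => ⟪f s - f b, deriv f s⟫_ℝ)
      (volume.restrict (uIoc a b)) :=
    (intervalIntegrable_iff.1 (intervalIntegrable_inner_of_continuousOn hcont
      (intervalIntegrable_deriv_of_absolutelyContinuousOnInterval hf))).1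
  refine le_of_tendsto (tendsto_integral_rpow_sub_add_smul hγ hab hmeas hint) ?_
  filter_upwards [self_mem_nhdsWithin] with ε (hε : 0 < ε)
  refine integral_mul_inner_sub_right_deriv_nonpos hab
    (absolutelyContinuousOnInterval_rpow_sub_add hε hab) (fun s _ t ht hst => ?_)
    (Real.rpow_nonneg (by linarith) _) hf
  exact Real.rpow_le_rpow_of_nonpos (by linarith [ht.2]) (by linarith) (by linarith)

lemma integral_rpow_sub_mul_inner_deriv_le (hγ : 0 ≤ γ) (hab : a ≤ b)
    (hf : AbsolutelyContinuousOnInterval f a b)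
    (hi : IntervalIntegrable (fun s => ((b - s) ^ (-γ) : ℝ) • deriv f s) volume a b) :
    ∫ s in a..b, (b - s) ^ (-γ) * ⟪f s, deriv f s⟫_ℝ ≤
      ⟪f b, ∫ s in a..b, ((b - s) ^ (-γ) : ℝ) • deriv f s⟫_ℝ := by
  have hsplit : ∫ s in a..b, (b - s) ^ (-γ) * ⟪f s - f b, deriv f s⟫_ℝ =
      (∫ s in a..b, (b - s) ^ (-γ) * ⟪f s, deriv f s⟫_ℝ) -
        ⟪f b, ∫ s in a..b, ((b - s) ^ (-γ) : ℝ) • deriv f s⟫_ℝ := by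
    simp only [inner_sub_left, mul_sub, ← real_inner_smul_right]
    rw [intervalIntegral.integral_sub (intervalIntegrable_inner_of_continuousOn hf.continuousOn hi)
      (intervalIntegrable_inner_of_continuousOn continuousOn_const hi)]
    congr 1
    exact (innerSL ℝ (f b)).intervalIntegral_comp_comm hi
  linarith [integral_rpow_sub_mul_inner_sub_right_nonpos hγ hab hf hi]

end CaputoPositivity

section TemperedKernel

variable {γ r : ℝ}

/-- The primitive `∫_0^u e^{-rv} v^{-γ} dv` of the tempered kernel: it is what remains of the
kernel `(t - s)^{-γ}` after integrating the weight `e^{-r(t - s)}` over `t`. -/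
noncomputable def temperedPrimitive (γ r u : ℝ) : ℝ :=
  ∫ v in (0 : ℝ)..u, Real.exp (-(r * v)) * v ^ (-γ)

lemma intervalIntegrable_exp_mul_rpow (hγ1 : γ < 1) (r c d : ℝ) :
    IntervalIntegrable (fun v : ℝ => Real.exp (-(r * v)) * v ^ (-γ)) volume c d :=
  (intervalIntegral.intervalIntegrable_rpow' (by linarith)).continuousOn_mul (by fun_prop)

lemma temperedPrimitive_le {u : ℝ} (hγ1 : γ < 1) (hr : 0 ≤ r) (hu : 0 ≤ u) :
    temperedPrimitive γ r u ≤ u ^ (1 - γ) / (1 - γ) := by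
  have hpow : ∫ v in (0 : ℝ)..u, v ^ (-γ) = u ^ (1 - γ) / (1 - γ) := by
    rw [integral_rpow (Or.inl (by linarith)), Real.zero_rpow (by linarith), sub_zero,
      neg_add_eq_sub]
  rw [← hpow]
  refine intervalIntegral.integral_mono_on hu (intervalIntegrable_exp_mul_rpow hγ1 r 0 u)
    (intervalIntegral.intervalIntegrable_rpow' (by linarith)) fun v hv => ?_
  exact mul_le_of_le_one_left (Real.rpow_nonneg hv.1 _)
    (Real.exp_le_one_iff.2 (neg_nonpos.2 (mul_nonneg hr hv.1)))

lemma hasDerivAt_exp_neg_mul (r s : ℝ) :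
    HasDerivAt (fun s : ℝ => Real.exp (-(r * s))) (-(r * Real.exp (-(r * s)))) s :=
  ((hasDerivAt_id s).const_mul r).neg.exp.congr_deriv (by simp [mul_comm])

lemma rpow_neg_le_temperedPrimitive {u : ℝ} (hγ : 0 ≤ γ) (hγ1 : γ < 1) (hr : 0 ≤ r) (hu : 0 < u) :
    u ^ (-γ) ≤ r * temperedPrimitive γ r u + Real.exp (-(r * u)) * u ^ (-γ) := by
  have hexp : ∫ v in (0 : ℝ)..u, r * Real.exp (-(r * v)) = 1 - Real.exp (-(r * u)) := by
    rw [intervalIntegral.integral_eq_sub_of_hasDerivAt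
      (fun v _ => ((hasDerivAt_exp_neg_mul r v).neg.congr_deriv (neg_neg _)))
      (Continuous.intervalIntegrable (by fun_prop) _ _)]
    simp only [Pi.neg_apply, mul_zero, neg_zero, Real.exp_zero, sub_neg_eq_add, neg_add_eq_sub]
  have hle : ∫ v in (0 : ℝ)..u, u ^ (-γ) * (r * Real.exp (-(r * v))) ≤
      r * temperedPrimitive γ r u := by
    rw [temperedPrimitive, ← intervalIntegral.integral_const_mul]
    refine intervalIntegral.integral_mono_on_of_le_Ioo hu.le
      (Continuous.intervalIntegrable (by fun_prop) _ _)
      ((intervalIntegrable_exp_mul_rpow hγ1 r 0 u).const_mul _) fun v hv => ?_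
    calc u ^ (-γ) * (r * Real.exp (-(r * v)))
        ≤ v ^ (-γ) * (r * Real.exp (-(r * v))) := by
          gcongr ?_ * _
          exact Real.rpow_le_rpow_of_nonpos hv.1 hv.2.le (by linarith)
      _ = r * (Real.exp (-(r * v)) * v ^ (-γ)) := by ring
  rw [intervalIntegral.integral_const_mul, hexp] at hle
  linarith

lemma setIntegral_exp_mul_singularKernel {τ s : ℝ} (hs : s ∈ Ioc 0 τ) :
    ∫ t in Ioc 0 τ, Real.exp (-(r * t)) * singularKernel γ (t - s) =
      Real.exp (-(r * s)) * temperedPrimitive γ r (τ - s) := by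
  have hI : Ioc s τ = Ioc 0 τ ∩ Ioi s := by
    ext t
    exact ⟨fun h => ⟨⟨hs.1.trans h.1, h.2⟩, h.1⟩, fun h => ⟨h.2, h.1.2⟩⟩
  have hshift : ∫ t in Ioc 0 τ, Real.exp (-(r * t)) * singularKernel γ (t - s) =
      ∫ t in s..τ, Real.exp (-(r * s)) * (Real.exp (-(r * (t - s))) * (t - s) ^ (-γ)) := by
    rw [intervalIntegral.integral_of_le hs.2, hI, ← setIntegral_indicator measurableSet_Ioi]
    refine integral_congr_ae (Eventually.of_forall fun t => ?_)
    by_cases h : s < t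
    · simp only [mem_Ioi, h, indicator_of_mem, singularKernel_of_pos (sub_pos.2 h)]
      rw [← mul_assoc, ← Real.exp_add]
      ring_nf
    · simp [h, singularKernel_of_nonpos (sub_nonpos.2 (not_lt.1 h))]
  rw [hshift, intervalIntegral.integral_const_mul, temperedPrimitive,
    intervalIntegral.integral_comp_sub_right
      (fun v => Real.exp (-(r * v)) * v ^ (-γ)) s, sub_self]

lemma temperedPrimitive_sub_eq (γ r τ s : ℝ) :
    temperedPrimitive γ r (τ - s) =
      -∫ w in τ..s, Real.exp (-(r * (τ - w))) * (τ - w) ^ (-γ) := by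
  rw [intervalIntegral.integral_comp_sub_left
    (fun v => Real.exp (-(r * v)) * v ^ (-γ)) τ, sub_self, temperedPrimitive,
    intervalIntegral.integral_symm]

lemma intervalIntegrable_exp_mul_rpow_sub_left (hγ1 : γ < 1) (r τ : ℝ) :
    IntervalIntegrable (fun w => Real.exp (-(r * (τ - w))) * (τ - w) ^ (-γ)) volume 0 τ := by
  simpa using (intervalIntegrable_exp_mul_rpow hγ1 r τ 0).comp_sub_left τ

/-- The kernel `∫_s^τ e^{-rt} (t - s)^{-γ} dt` that multiplies `⟪f, f'⟫` when the weighted integral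
over `(0, τ)` of `⟪f, D^γ f⟫` is evaluated with the order of integration exchanged. -/
noncomputable def temperedWeight (γ r τ s : ℝ) : ℝ :=
  Real.exp (-(r * s)) * temperedPrimitive γ r (τ - s)

lemma absolutelyContinuousOnInterval_temperedWeight (hγ1 : γ < 1) (r τ : ℝ) :
    AbsolutelyContinuousOnInterval (temperedWeight γ r τ) 0 τ := by
  have hP : AbsolutelyContinuousOnInterval (fun s => temperedPrimitive γ r (τ - s)) 0 τ := by
    simpa only [temperedPrimitive_sub_eq] using ((intervalIntegrable_exp_mul_rpow_sub_left hγ1 r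
      τ).absolutelyContinuousOnInterval_intervalIntegral right_mem_uIcc).fun_neg
  exact (ContDiffOn.absolutelyContinuousOnInterval
    (by fun_prop : ContDiffOn ℝ 1 (fun s : ℝ => Real.exp (-(r * s))) (uIcc 0 τ))).fun_mul hP

lemma ae_rpow_mul_exp_le_neg_deriv_temperedWeight {τ : ℝ} (hγ : 0 ≤ γ) (hγ1 : γ < 1) (hr : 0 ≤ r)
    (hτ : 0 ≤ τ) :
    ∀ᵐ s ∂(volume.restrict (Icc 0 τ)),
      (τ - s) ^ (-γ) * Real.exp (-(r * s)) ≤ -deriv (temperedWeight γ r τ) s := by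
  have hi := intervalIntegrable_exp_mul_rpow_sub_left hγ1 r τ
  filter_upwards [ae_restrict_of_ae hi.ae_hasDerivAt_integral, ae_restrict_mem measurableSet_Icc,
    show ∀ᵐ s ∂(volume.restrict (Icc 0 τ)), s ≠ τ from
      ae_restrict_of_ae (by simp [ae_iff, measure_singleton])] with s hs hsI hsτ
  have hP : HasDerivAt (fun s => temperedPrimitive γ r (τ - s))
      (-(Real.exp (-(r * (τ - s))) * (τ - s) ^ (-γ))) s := by
    simpa only [temperedPrimitive_sub_eq] using
      (hs (by rwa [uIcc_of_le hτ]) τ right_mem_uIcc).fun_neg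
  have hW : deriv (temperedWeight γ r τ) s = _ := ((hasDerivAt_exp_neg_mul r s).fun_mul hP).deriv
  rw [hW]
  have hle := mul_le_mul_of_nonneg_right (rpow_neg_le_temperedPrimitive hγ hγ1 hr
    (sub_pos.2 (lt_of_le_of_ne hsI.2 hsτ))) (Real.exp_nonneg (-(r * s)))
  linarith

end TemperedKernel

section WeightedCaputo

variable {E : Type*} [NormedAddCommGroup E] [InnerProductSpace ℝ E] [FiniteDimensional ℝ E]
  {γ r τ : ℝ} {f : ℝ → E}

lemma temperedWeight_self (γ r τ : ℝ) : temperedWeight γ r τ τ = 0 := by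
  simp [temperedWeight, temperedPrimitive]

lemma temperedWeight_zero_le (hγ1 : γ < 1) (hr : 0 ≤ r) (hτ : 0 ≤ τ) :
    temperedWeight γ r τ 0 ≤ τ ^ (1 - γ) / (1 - γ) := by
  simpa [temperedWeight] using temperedPrimitive_le hγ1 hr hτ

lemma integral_temperedWeight_mul_inner_deriv_ge (hγ : 0 ≤ γ) (hγ1 : γ < 1) (hr : 0 ≤ r)
    (hτ : 0 ≤ τ) (hf : AbsolutelyContinuousOnInterval f 0 τ) :
    ((∫ s in (0 : ℝ)..τ, (τ - s) ^ (-γ) * (Real.exp (-(r * s)) * ‖f s‖ ^ 2)) -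
        τ ^ (1 - γ) / (1 - γ) * ‖f 0‖ ^ 2) / 2 ≤
      ∫ s in (0 : ℝ)..τ, temperedWeight γ r τ s * ⟪f s, deriv f s⟫_ℝ := by
  have hW := absolutelyContinuousOnInterval_temperedWeight hγ1 r τ
  have hsq : ContinuousOn (fun s => ‖f s‖ ^ 2) (uIcc 0 τ) := hf.continuousOn.norm.pow 2
  have hparts : ∫ s in (0 : ℝ)..τ, temperedWeight γ r τ s * ⟪f s, deriv f s⟫_ℝ =
      ((∫ s in (0 : ℝ)..τ, -deriv (temperedWeight γ r τ) s * ‖f s‖ ^ 2) -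
        temperedWeight γ r τ 0 * ‖f 0‖ ^ 2) / 2 := by
    have h := integral_mul_inner_sub_deriv hW hf 0
    simp only [sub_zero, temperedWeight_self, zero_mul] at h
    simp only [h, neg_mul, intervalIntegral.integral_neg]
    ring
  have hderiv : ∫ s in (0 : ℝ)..τ, (τ - s) ^ (-γ) * (Real.exp (-(r * s)) * ‖f s‖ ^ 2) ≤
      ∫ s in (0 : ℝ)..τ, -deriv (temperedWeight γ r τ) s * ‖f s‖ ^ 2 := by
    refine intervalIntegral.integral_mono_ae_restrict hτ
      ((intervalIntegrable_rpow_sub_left hγ1 0 τ).mul_continuousOn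
        (ContinuousOn.mul (by fun_prop) hsq))
      (hW.intervalIntegrable_deriv.neg.mul_continuousOn hsq) ?_
    filter_upwards [ae_rpow_mul_exp_le_neg_deriv_temperedWeight hγ hγ1 hr hτ] with s hs
    simpa only [mul_assoc] using mul_le_mul_of_nonneg_right hs (sq_nonneg ‖f s‖)
  have hinit := mul_le_mul_of_nonneg_right (temperedWeight_zero_le hγ1 hr hτ) (sq_nonneg ‖f 0‖)
  rw [hparts]
  linarith

lemma integrable_exp_mul_singularKernel_mul (hγ1 : γ < 1) (hr : 0 ≤ r) {g : ℝ → ℝ}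
    (hg : IntegrableOn g (Ioc 0 τ)) :
    Integrable (fun p : ℝ × ℝ => Real.exp (-(r * p.1)) * (singularKernel γ (p.1 - p.2) * g p.2))
      ((volume.restrict (Ioc 0 τ)).prod (volume.restrict (Ioc 0 τ))) := by
  refine (integrable_singularKernel_sub_smul hγ1 hg).bdd_mul (c := 1)
    (by fun_prop : Continuous _).aestronglyMeasurable ?_
  rw [Measure.prod_restrict]
  filter_upwards [ae_restrict_mem (measurableSet_Ioc.prod measurableSet_Ioc)] with p hp
  rw [Real.norm_of_nonneg (Real.exp_nonneg _), Real.exp_le_one_iff]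
  exact neg_nonpos.2 (mul_nonneg hr hp.1.1.le)

lemma integral_temperedWeight_mul (hγ1 : γ < 1) (hr : 0 ≤ r) (hτ : 0 ≤ τ) {g : ℝ → ℝ}
    (hg : IntegrableOn g (Ioc 0 τ)) :
    ∫ s in (0 : ℝ)..τ, temperedWeight γ r τ s * g s =
      ∫ t in Ioc 0 τ, Real.exp (-(r * t)) * ∫ s in Ioc 0 τ, singularKernel γ (t - s) * g s := by
  simp only [← integral_const_mul]
  rw [integral_integral_swap (integrable_exp_mul_singularKernel_mul hγ1 hr hg),
    intervalIntegral.integral_of_le hτ]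
  refine setIntegral_congr_fun measurableSet_Ioc fun s hs => ?_
  simp only [temperedWeight, ← setIntegral_exp_mul_singularKernel hs, ← integral_mul_const,
    mul_assoc]

lemma integrableOn_exp_mul_inner_caputo (hγ1 : γ < 1) (r : ℝ) (hτ : 0 ≤ τ)
    (hf : AbsolutelyContinuousOnInterval f 0 τ) :
    IntegrableOn (fun t => Real.exp (-(r * t)) *
      ⟪f t, ∫ s in (0 : ℝ)..t, ((t - s) ^ (-γ) : ℝ) • deriv f s⟫_ℝ) (Ioc 0 τ) := by
  have hD : IntervalIntegrable (fun t => ∫ s in (0 : ℝ)..t, ((t - s) ^ (-γ) : ℝ) • deriv f s)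
      volume 0 τ :=
    (intervalIntegrable_iff_integrableOn_Ioc_of_le hτ).2 <| integrableOn_integral_rpow_sub_smul hγ1
      ((intervalIntegrable_iff_integrableOn_Ioc_of_le hτ).1
        (intervalIntegrable_deriv_of_absolutelyContinuousOnInterval hf))
  exact (intervalIntegrable_iff_integrableOn_Ioc_of_le hτ).1
    ((intervalIntegrable_inner_of_continuousOn hf.continuousOn hD).continuousOn_mul (by fun_prop))

lemma integral_exp_mul_inner_caputo_ge (hγ : 0 ≤ γ) (hγ1 : γ < 1) (hr : 0 ≤ r) (hτ : 0 ≤ τ)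
    (hf : AbsolutelyContinuousOnInterval f 0 τ) :
    ((∫ s in (0 : ℝ)..τ, (τ - s) ^ (-γ) * (Real.exp (-(r * s)) * ‖f s‖ ^ 2)) -
        τ ^ (1 - γ) / (1 - γ) * ‖f 0‖ ^ 2) / 2 ≤
      ∫ t in Ioc 0 τ, Real.exp (-(r * t)) *
        ⟪f t, ∫ s in (0 : ℝ)..t, ((t - s) ^ (-γ) : ℝ) • deriv f s⟫_ℝ := by
  have hf' := intervalIntegrable_deriv_of_absolutelyContinuousOnInterval hf
  have hff' : IntegrableOn (fun s => ⟪f s, deriv f s⟫_ℝ) (Ioc 0 τ) :=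
    (intervalIntegrable_iff_integrableOn_Ioc_of_le hτ).1
      (intervalIntegrable_inner_of_continuousOn hf.continuousOn hf')
  refine (integral_temperedWeight_mul_inner_deriv_ge hγ hγ1 hr hτ hf).trans ?_
  rw [integral_temperedWeight_mul hγ1 hr hτ hff']
  refine integral_mono_ae ?_ (integrableOn_exp_mul_inner_caputo hγ1 r hτ hf) ?_
  · simpa only [integral_const_mul] using
      (integrable_exp_mul_singularKernel_mul hγ1 hr hff').integral_prod_left
  filter_upwards [ae_restrict_mem measurableSet_Ioc, ae_intervalIntegrable_rpow_sub_smul hγ1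
    ((intervalIntegrable_iff_integrableOn_Ioc_of_le hτ).1 hf')] with t ht hi
  refine mul_le_mul_of_nonneg_left ?_ (Real.exp_nonneg _)
  have hker := setIntegral_singularKernel_sub_smul γ (Ioc_subset_Icc_self ht)
    (fun s => ⟪f s, deriv f s⟫_ℝ)
  simp only [smul_eq_mul] at hker
  rw [hker]
  refine integral_rpow_sub_mul_inner_deriv_le hγ ht.1.le (hf.mono ?_) hi
  rw [uIcc_of_le hτ, uIcc_of_le ht.1.le]
  exact Icc_subset_Icc_right ht.2

end WeightedCaputo

section SubstantialDerivative

variable {γ a b t τ T : ℝ} {q : ℂ} {y : ℝ → ℂ}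

lemma absolutelyContinuousOnInterval_exp_mul (q : ℂ) (hy : AbsolutelyContinuousOnInterval y a b) :
    AbsolutelyContinuousOnInterval (fun s : ℝ => Complex.exp (q * s) * y s) a b :=
  (ContDiffOn.absolutelyContinuousOnInterval ((contDiff_const.mul
    Complex.ofRealCLM.contDiff).cexp (n := 1)).contDiffOn).fun_smul hy

lemma hasDerivAt_exp_mul (q : ℂ) {y' : ℂ} {s : ℝ} (hy : HasDerivAt y y' s) :
    HasDerivAt (fun s : ℝ => Complex.exp (q * s) * y s)
      (Complex.exp (q * s) * (y' + q * y s)) s := by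
  have hexp : HasDerivAt (fun s : ℝ => Complex.exp (q * s)) (Complex.exp (q * s) * (q * 1)) s :=
    ((Complex.ofRealCLM.hasDerivAt (x := s)).const_mul q).cexp
  exact (hexp.mul hy).congr_deriv (by ring)

/-- The Caputo substantial derivative of a function `y` of time only, for a constant tempering
parameter `q` and without the normalizing factor `1 / Γ(1 - γ)`. -/
noncomputable def substantialIntegral (γ : ℝ) (q : ℂ) (y : ℝ → ℂ) (t : ℝ) : ℂ :=
  Complex.exp (-(q * t)) * ∫ s in (0 : ℝ)..t, ((t - s) ^ (-γ) : ℝ) •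
    (Complex.exp (q * s) * (deriv y s + q * y s))

lemma substantialIntegral_eq (ht : t ∈ Icc 0 τ) (hy : AbsolutelyContinuousOnInterval y 0 τ) :
    substantialIntegral γ q y t = Complex.exp (-(q * t)) *
      ∫ s in (0 : ℝ)..t, ((t - s) ^ (-γ) : ℝ) •
        deriv (fun s : ℝ => Complex.exp (q * s) * y s) s := by
  have hsub : uIoc 0 t ⊆ uIcc 0 τ := by
    rw [uIoc_of_le ht.1, uIcc_of_le (ht.1.trans ht.2)]
    exact fun s hs => ⟨hs.1.le, hs.2.trans ht.2⟩
  rw [substantialIntegral]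
  congr 1
  refine intervalIntegral.integral_congr_ae ?_
  filter_upwards [ae_differentiableAt_of_absolutelyContinuousOnInterval hy] with s hdiff hs
  rw [(hasDerivAt_exp_mul q (hdiff (hsub hs)).hasDerivAt).deriv]

lemma exp_mul_norm_sq_exp_mul (q z : ℂ) (s : ℝ) :
    Real.exp (-(2 * q.re * s)) * ‖Complex.exp (q * s) * z‖ ^ 2 = ‖z‖ ^ 2 := by
  rw [norm_mul, Complex.norm_exp, mul_pow, ← mul_assoc, ← Real.exp_nat_mul, ← Real.exp_add]
  simp [mul_assoc]

lemma re_exp_neg_mul_mul_conj (q z w : ℂ) (t : ℝ) :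
    (Complex.exp (-(q * t)) * w * (starRingEnd ℂ) z).re =
      Real.exp (-(2 * q.re * t)) * ⟪Complex.exp (q * t) * z, w⟫_ℝ := by
  have hexp : Complex.exp (-(q * t)) =
      Real.exp (-(2 * q.re * t)) * (starRingEnd ℂ) (Complex.exp (q * t)) := by
    rw [← Complex.exp_conj, Complex.ofReal_exp, ← Complex.exp_add]
    congr 1
    apply Complex.ext <;> simp
    ring
  rw [Complex.inner, ← Complex.re_ofReal_mul, hexp, map_mul]
  ring_nf

lemma re_substantialIntegral_mul_conj (ht : t ∈ Icc 0 τ)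
    (hy : AbsolutelyContinuousOnInterval y 0 τ) :
    (substantialIntegral γ q y t * (starRingEnd ℂ) (y t)).re =
      Real.exp (-(2 * q.re * t)) * ⟪Complex.exp (q * t) * y t,
        ∫ s in (0 : ℝ)..t, ((t - s) ^ (-γ) : ℝ) •
          deriv (fun s : ℝ => Complex.exp (q * s) * y s) s⟫_ℝ := by
  rw [substantialIntegral_eq ht hy, re_exp_neg_mul_mul_conj]

lemma integral_re_substantialIntegral_mul_conj_ge (hγ : 0 ≤ γ) (hγ1 : γ < 1) (hτ : 0 ≤ τ)
    (hq : 0 ≤ q.re) (hy : AbsolutelyContinuousOnInterval y 0 τ) :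
    ((∫ s in (0 : ℝ)..τ, (τ - s) ^ (-γ) * ‖y s‖ ^ 2) - τ ^ (1 - γ) / (1 - γ) * ‖y 0‖ ^ 2) / 2 ≤
      ∫ t in Ioc 0 τ, (substantialIntegral γ q y t * (starRingEnd ℂ) (y t)).re := by
  rw [setIntegral_congr_fun measurableSet_Ioc fun t ht =>
    re_substantialIntegral_mul_conj (Ioc_subset_Icc_self ht) hy]
  have h := integral_exp_mul_inner_caputo_ge hγ hγ1 (mul_nonneg zero_le_two hq) hτ
    (absolutelyContinuousOnInterval_exp_mul q hy)
  simpa only [exp_mul_norm_sq_exp_mul, Complex.ofReal_zero, mul_zero, Complex.exp_zero,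
    one_mul] using h

lemma rpow_neg_mul_integral_norm_sq_le (hγ : 0 ≤ γ) (hγ1 : γ < 1) (hτ : 0 ≤ τ) (hτT : τ ≤ T)
    (hy : ContinuousOn y (uIcc 0 τ)) :
    T ^ (-γ) * (∫ s in Ioc 0 τ, ‖y s‖ ^ 2) ≤
      ∫ s in (0 : ℝ)..τ, (τ - s) ^ (-γ) * ‖y s‖ ^ 2 := by
  have hsq : ContinuousOn (fun s => ‖y s‖ ^ 2) (uIcc 0 τ) := hy.norm.pow 2
  rw [← intervalIntegral.integral_of_le hτ, ← intervalIntegral.integral_const_mul]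
  refine intervalIntegral.integral_mono_on_of_le_Ioo hτ (hsq.intervalIntegrable.const_mul _)
    ((intervalIntegrable_rpow_sub_left hγ1 0 τ).mul_continuousOn hsq) fun s hs => ?_
  exact mul_le_mul_of_nonneg_right (Real.rpow_le_rpow_of_nonpos (by linarith [hs.2])
    (by linarith [hs.1]) (by linarith)) (sq_nonneg _)

lemma integral_substantialIntegral_ge (hγ : 0 ≤ γ) (hγ1 : γ < 1) (hτ : 0 ≤ τ) (hτT : τ ≤ T)
    (hq : 0 ≤ q.re) (hy : AbsolutelyContinuousOnInterval y 0 τ) :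
    (T ^ (-γ) * (∫ s in Ioc 0 τ, ‖y s‖ ^ 2) - T ^ (1 - γ) / (1 - γ) * ‖y 0‖ ^ 2) / 2 ≤
      ∫ t in Ioc 0 τ, (substantialIntegral γ q y t * (starRingEnd ℂ) (y t)).re := by
  have hinit : τ ^ (1 - γ) / (1 - γ) * ‖y 0‖ ^ 2 ≤ T ^ (1 - γ) / (1 - γ) * ‖y 0‖ ^ 2 := by
    have := sub_pos.2 hγ1
    gcongr
  linarith [integral_re_substantialIntegral_mul_conj_ge hγ hγ1 hτ hq hy,
    rpow_neg_mul_integral_norm_sq_le hγ hγ1 hτ hτT hy.continuousOn]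

end SubstantialDerivative

section DividedDifferences

variable {τ : ℕ → ℝ} {f : ℝ → ℝ}

lemma dividedDiff_mem_of_iteratedDeriv_mem {X : Type*} (W : Submodule ℝ (X → ℝ)) (F : X → ℝ → ℝ)
    (τ : ℕ → ℝ) (n m : ℕ)
    (h : ∀ l i, m ≤ l → l + i ≤ m + n → τ (l + i) = τ l →
      (fun x => iteratedDeriv i (F x) (τ l)) ∈ W) :
    (fun x => dividedDiff (F x) τ n m) ∈ W := by
  induction n generalizing m with
  | zero => simpa [dividedDiff] using h m 0 le_rfl le_rfl rfl
  | succ n ih =>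
    by_cases hτ : τ (m + n + 1) = τ m
    · simp only [dividedDiff, hτ, if_true, div_eq_inv_mul]
      exact W.smul_mem _ (h m (n + 1) le_rfl le_rfl hτ)
    · simp only [dividedDiff, hτ, if_false, div_eq_inv_mul]
      exact W.smul_mem _ (W.sub_mem (ih (m + 1) fun l i hl hi => h l i (by omega) (by omega))
        (ih m fun l i hl hi => h l i hl (by omega)))

lemma dividedDiff_congr {g : ℝ → ℝ} {n m : ℕ}
    (h : ∀ l i, m ≤ l → l + i ≤ m + n → τ (l + i) = τ l →
      iteratedDeriv i f (τ l) = iteratedDeriv i g (τ l)) :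
    dividedDiff f τ n m = dividedDiff g τ n m := by
  induction n generalizing m with
  | zero => simpa [dividedDiff] using h m 0 le_rfl le_rfl rfl
  | succ n ih =>
    by_cases hτ : τ (m + n + 1) = τ m
    · simp only [dividedDiff, hτ, if_true, h m (n + 1) le_rfl le_rfl hτ]
    · simp only [dividedDiff, hτ, if_false]
      rw [ih fun l i hl hi => h l i (by omega) (by omega),
        ih fun l i hl hi => h l i hl (by omega)]

lemma dividedDiff_of_eq (f : ℝ → ℝ) {n m : ℕ} (h : τ (m + n) = τ m) :
    dividedDiff f τ n m = iteratedDeriv n f (τ m) / (Nat.factorial n : ℝ) := by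
  cases n with
  | zero => simp [dividedDiff]
  | succ n => simp [dividedDiff, show τ (m + n + 1) = τ m from h]

lemma sub_mul_dividedDiff_succ (hτ : Monotone τ) (f : ℝ → ℝ) (n m : ℕ) :
    (τ (m + n + 1) - τ m) * dividedDiff f τ (n + 1) m =
      dividedDiff f τ n (m + 1) - dividedDiff f τ n m := by
  by_cases h : τ (m + n + 1) = τ m
  · have hfirst : τ (m + 1) = τ m := le_antisymm (h ▸ hτ (by omega)) (hτ (by omega))
    have hlast : τ (m + n) = τ m := le_antisymm (h ▸ hτ (by omega)) (hτ (by omega))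
    rw [h, sub_self, zero_mul, dividedDiff_of_eq f hlast, dividedDiff_of_eq f (m := m + 1)
      (by rw [hfirst, ← h, add_right_comm]), hfirst, sub_self]
  · rw [dividedDiff, if_neg h, mul_div_cancel₀ _ (sub_ne_zero.2 h)]

lemma iteratedDeriv_id_mul_succ {n : ℕ} (hf : ContDiff ℝ (n + 1) f) (x : ℝ) :
    iteratedDeriv (n + 1) (fun t => t * f t) x =
      x * iteratedDeriv (n + 1) f x + (n + 1) * iteratedDeriv n f x := by
  rw [iteratedDeriv_fun_mul contDiffAt_id (by exact_mod_cast hf.contDiffAt),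
    Finset.sum_range_succ', Finset.sum_range_succ', Finset.sum_eq_zero]
  · simp; ring
  · intro i _
    simp [iteratedDeriv_succ', iteratedDeriv_const]

lemma dividedDiff_id_mul_succ (hτ : Monotone τ) {n : ℕ} (hf : ContDiff ℝ (n + 1) f) (m : ℕ) :
    dividedDiff (fun t => t * f t) τ (n + 1) m =
      τ m * dividedDiff f τ (n + 1) m + dividedDiff f τ n (m + 1) := by
  by_cases h : τ (m + n + 1) = τ m
  · have hfirst : τ (m + 1) = τ m := le_antisymm (h ▸ hτ (by omega)) (hτ (by omega))
    rw [dividedDiff_of_eq _ (by rwa [← add_assoc]), dividedDiff_of_eq f (by rwa [← add_assoc]),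
      dividedDiff_of_eq f (m := m + 1) (by rw [hfirst, ← h, add_right_comm]), hfirst,
      iteratedDeriv_id_mul_succ hf, Nat.factorial_succ]
    push_cast
    field_simp
  refine mul_left_cancel₀ (sub_ne_zero.2 h) ?_
  have hf_rec := sub_mul_dividedDiff_succ hτ f n m
  have htf_rec := sub_mul_dividedDiff_succ hτ (fun t => t * f t) n m
  cases n with
  | zero =>
    simp only [dividedDiff] at htf_rec hf_rec ⊢
    linear_combination htf_rec - τ m * hf_rec
  | succ n =>
    have hf' : ContDiff ℝ (n + 1) f := hf.of_le (by norm_cast; omega)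
    rw [dividedDiff_id_mul_succ hτ hf', dividedDiff_id_mul_succ hτ hf'] at htf_rec
    have hf_rec' := sub_mul_dividedDiff_succ hτ f n (m + 1)
    rw [show m + 1 + n + 1 = m + (n + 1) + 1 by omega] at hf_rec'
    linear_combination htf_rec - τ m * hf_rec - hf_rec'

lemma dividedDiff_pow_eq_zero (hτ : Monotone τ) {N n : ℕ} (h : N < n) (m : ℕ) :
    dividedDiff (fun t => t ^ N) τ n m = 0 := by
  obtain ⟨n, rfl⟩ := Nat.exists_eq_succ_of_ne_zero (by omega : n ≠ 0)
  induction N generalizing n m with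
  | zero =>
    simp only [pow_zero]
    clear h
    induction n generalizing m with
    | zero => simp [dividedDiff]
    | succ n ih => rw [dividedDiff, ih, ih]; simp [iteratedDeriv_const]
  | succ N ih =>
    obtain ⟨n, rfl⟩ := Nat.exists_eq_succ_of_ne_zero (by omega : n ≠ 0)
    simp only [pow_succ']
    rw [dividedDiff_id_mul_succ hτ (by fun_prop), ih _ _ (by omega), ih _ _ (by omega)]
    simp

end DividedDifferences

section TruncatedPowers

lemma hasDerivAt_max_zero_pow (k : ℕ) (t : ℝ) :
    HasDerivAt (fun t : ℝ => max 0 t ^ (k + 2)) ((k + 2) * max 0 t ^ (k + 1)) t := by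
  rcases lt_trichotomy t 0 with ht | rfl | ht
  · have hzero : (fun t : ℝ => max 0 t ^ (k + 2)) =ᶠ[𝓝 t] fun _ => 0 := by
      filter_upwards [gt_mem_nhds ht] with s hs
      simp [max_eq_left hs.le]
    rw [max_eq_left ht.le]
    simpa using (hasDerivAt_const t (0 : ℝ)).congr_of_eventuallyEq hzero
  · have hO : (fun t : ℝ => max 0 t ^ (k + 2)) =O[𝓝 0] fun t : ℝ => ‖t - 0‖ ^ (k + 2) := by
      refine Asymptotics.IsBigO.of_bound 1 (Eventually.of_forall fun s => ?_)
      rw [norm_pow, norm_pow, norm_norm, one_mul, sub_zero, Real.norm_eq_abs, Real.norm_eq_abs,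
        abs_of_nonneg (le_max_left _ _)]
      gcongr
      exact max_le (abs_nonneg _) (le_abs_self _)
    simpa using (hO.hasFDerivAt (by omega)).hasDerivAt
  · have hpow : (fun t : ℝ => max 0 t ^ (k + 2)) =ᶠ[𝓝 t] fun t => t ^ (k + 2) := by
      filter_upwards [lt_mem_nhds ht] with s hs
      rw [max_eq_right hs.le]
    rw [max_eq_right ht.le]
    simpa using (hasDerivAt_pow (k + 2) t).congr_of_eventuallyEq hpow

lemma iteratedDeriv_truncatedPower {n i : ℕ} (h : i < n) (x t : ℝ) :
    iteratedDeriv i (fun t : ℝ => max 0 (t - x) ^ n) t =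
      n.descFactorial i * max 0 (t - x) ^ (n - i) := by
  induction i generalizing t with
  | zero => simp
  | succ i ih =>
    obtain ⟨k, hk⟩ : ∃ k, n - i = k + 2 := ⟨n - i - 2, by omega⟩
    rw [iteratedDeriv_succ, funext fun t => ih (by omega) t, hk,
      show n - (i + 1) = k + 1 by omega]
    have hderiv := ((hasDerivAt_max_zero_pow k (t - x)).comp t
      ((hasDerivAt_id t).sub_const x)).const_mul (n.descFactorial i : ℝ)
    refine hderiv.deriv.trans ?_
    rw [Nat.descFactorial_succ, hk]
    push_cast
    ring

lemma iteratedDeriv_truncatedPower_zero {n i : ℕ} (h : i < n) {t : ℝ} (ht : 0 ≤ t) :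
    iteratedDeriv i (fun t : ℝ => max 0 (t - 0) ^ n) t = iteratedDeriv i (fun t => t ^ n) t := by
  rw [iteratedDeriv_truncatedPower h, sub_zero, max_eq_right ht, iteratedDeriv_eq_iterate,
    iter_deriv_pow, ← descPochhammer_eval_eq_prod_range, descPochhammer_eval_eq_descFactorial]

lemma lipschitzOnWith_truncatedPower {τ : ℝ} (hτ : τ ≤ 1) (e : ℕ) :
    LipschitzOnWith e (fun x : ℝ => max 0 (τ - x) ^ e) (Icc 0 1) := by
  refine LipschitzOnWith.of_dist_le_mul fun x hx y hy => ?_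
  have hbound z (hz : z ∈ Icc (0 : ℝ) 1) : |max 0 (τ - z)| ≤ 1 := by
    rw [abs_of_nonneg (le_max_left _ _)]
    exact max_le zero_le_one (by linarith [hz.1])
  have hmax : max |max 0 (τ - x)| |max 0 (τ - y)| ^ (e - 1) ≤ 1 :=
    pow_le_one₀ (le_max_of_le_left (abs_nonneg _)) (max_le (hbound x hx) (hbound y hy))
  have hdist : |max 0 (τ - x) - max 0 (τ - y)| ≤ |x - y| := by
    have h := abs_max_sub_max_le_abs (τ - x) (τ - y) 0
    rwa [sub_sub_sub_cancel_left, abs_sub_comm y x, max_comm, max_comm (τ - y)] at h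
  rw [Real.dist_eq, Real.dist_eq]
  calc |max 0 (τ - x) ^ e - max 0 (τ - y) ^ e|
      ≤ |max 0 (τ - x) - max 0 (τ - y)| * e * max |max 0 (τ - x)| |max 0 (τ - y)| ^ (e - 1) :=
        abs_pow_sub_pow_le _ _ _
    _ ≤ |x - y| * e * 1 := by gcongr
    _ = (e : NNReal) * |x - y| := by rw [mul_one, mul_comm, NNReal.coe_natCast]

end TruncatedPowers

section Splines

variable {d j k : ℕ}

lemma knot_mono (d j : ℕ) : Monotone (knot d j) := fun i k h => by
  unfold knot
  gcongr

lemma knot_nonneg (d j i : ℕ) : 0 ≤ knot d j i := le_max_left _ _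

lemma knot_le_one (d j i : ℕ) : knot d j i ≤ 1 := max_le zero_le_one (min_le_left _ _)

lemma le_or_le_of_knot_eq {l i : ℕ} (hi : 0 < i) (h : knot d j (l + i) = knot d j l) :
    l + i ≤ d ∨ d + 2 ^ j ≤ l := by
  by_contra! hcon
  have hright : (0 : ℝ) < (l + i : ℕ) - d := sub_pos.2 (by exact_mod_cast hcon.1)
  have hleft : (l : ℝ) - d < 2 ^ j := sub_lt_iff_lt_add'.2 (by exact_mod_cast hcon.2)
  have hlt : ((l : ℝ) - d) / 2 ^ j < ((l + i : ℕ) - d) / 2 ^ j := by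
    gcongr
    omega
  have hlt_one : ((l : ℝ) - d) / 2 ^ j < 1 := by rwa [div_lt_one (by positivity)]
  refine (max_lt ?_ ?_ : knot d j l < knot d j (l + i)).ne' h
  · exact lt_max_of_lt_right (lt_min one_pos (by positivity))
  · exact lt_max_of_lt_right (lt_min ((min_le_right _ _).trans_lt hlt_one)
      ((min_le_right _ _).trans_lt hlt))

lemma lt_of_knot_add_eq (hd : 2 ≤ d) (hk : k ∈ scalingIndex d j) {l i : ℕ} (hl : k + 1 ≤ l)
    (hli : l + i ≤ k + 1 + d) (h : knot d j (l + i) = knot d j l) : i < d - 1 := by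
  rcases Nat.eq_zero_or_pos i with rfl | hi
  · omega
  · have hk' := Finset.mem_Icc.1 hk
    generalize hN : 2 ^ j = N at hk'
    rcases le_or_le_of_knot_eq hi h with h | h <;> omega

/-- The `𝕜`-valued functions that are Lipschitz on `s` and vanish on `z`. -/
def lipschitzVanishingOn (𝕜 : Type*) [NormedField 𝕜] (s z : Set ℝ) : Submodule 𝕜 (ℝ → 𝕜) where
  carrier := {u | (∃ C, LipschitzOnWith C u s) ∧ EqOn u 0 z}
  zero_mem' := ⟨⟨0, (LipschitzWith.const 0).lipschitzOnWith⟩, fun _ _ => rfl⟩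
  add_mem' := by
    rintro u v ⟨⟨C, hC⟩, hu⟩ ⟨⟨D, hD⟩, hv⟩
    exact ⟨⟨C + D, hC.add hD⟩, fun x hx => by simp [hu hx, hv hx]⟩
  smul_mem' := by
    rintro c u ⟨⟨C, hC⟩, hu⟩
    exact ⟨⟨_, (lipschitzWith_smul c).comp_lipschitzOnWith hC⟩, fun x hx => by simp [hu hx]⟩

lemma bspline_mem_lipschitzVanishingOn_one (hd : 2 ≤ d) (hk : k ∈ scalingIndex d j) :
    bspline d j k ∈ lipschitzVanishingOn ℝ (Icc 0 1) {1} := by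
  refine Submodule.smul_mem _ (2 ^ ((j : ℝ) / 2) * (knot d j (k + d + 1) - knot d j (k + 1)))
    (dividedDiff_mem_of_iteratedDeriv_mem _ (fun x t => max 0 (t - x) ^ (d - 1)) _ _ _
      fun l i hl hli hi => ?_)
  have hlt := lt_of_knot_add_eq hd hk hl hli hi
  simp_rw [iteratedDeriv_truncatedPower hlt]
  refine Submodule.smul_mem _ ((d - 1).descFactorial i : ℝ)
    ⟨⟨_, lipschitzOnWith_truncatedPower (knot_le_one d j l) _⟩, fun x hx => ?_⟩
  obtain rfl := mem_singleton_iff.1 hx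
  simp only [max_eq_left (sub_nonpos.2 (knot_le_one d j l)), Pi.zero_apply]
  exact zero_pow (by omega)

-- On `[0, 1]` the function `(t - 0)_+^{d-1}` is a polynomial of degree less than `d`.
lemma bspline_zero (hd : 2 ≤ d) (hk : k ∈ scalingIndex d j) : bspline d j k 0 = 0 := by
  rw [bspline, dividedDiff_congr (g := fun t => t ^ (d - 1)) fun l i hl hli hi =>
    iteratedDeriv_truncatedPower_zero (lt_of_knot_add_eq hd hk hl hli hi) (knot_nonneg d j l),
    dividedDiff_pow_eq_zero (knot_mono d j) (by omega), mul_zero]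

lemma scaling_mem_lipschitzVanishingOn {a b : ℝ} (hab : a < b) (hd : 2 ≤ d)
    (hk : k ∈ scalingIndex d j) :
    scaling a b d j k ∈ lipschitzVanishingOn ℂ (Icc a b) {a, b} := by
  obtain ⟨⟨C, hC⟩, hone⟩ := bspline_mem_lipschitzVanishingOn_one hd hk
  have hba : 0 < b - a := sub_pos.2 hab
  have haffine : LipschitzWith (Real.nnabs (b - a)⁻¹) fun x : ℝ => (x - a) / (b - a) :=
    LipschitzWith.of_dist_le_mul fun x y => by
      rw [Real.dist_eq, Real.dist_eq, Real.coe_nnabs, ← abs_mul, ← sub_div,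
        sub_sub_sub_cancel_right, div_eq_inv_mul]
  have hmaps : MapsTo (fun x : ℝ => (x - a) / (b - a)) (Icc a b) (Icc 0 1) := fun x hx =>
    ⟨div_nonneg (sub_nonneg.2 hx.1) hba.le, (div_le_one hba).2 (by linarith [hx.2])⟩
  refine ⟨⟨_, Complex.isometry_ofReal.lipschitz.comp_lipschitzOnWith
    (hC.comp (haffine.lipschitzOnWith (s := Icc a b)) hmaps)⟩, ?_⟩
  rintro x (rfl | rfl)
  · simp [scaling, bspline_zero hd hk]
  · simp [scaling, div_self hba.ne', hone (mem_singleton 1)]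

lemma splineSpace_le_lipschitzVanishingOn {a b : ℝ} (hab : a < b) (hd : 2 ≤ d) (J : ℕ) :
    splineSpace a b d J ≤ lipschitzVanishingOn ℂ (Icc a b) {a, b} := by
  refine Submodule.span_le.2 ?_
  rintro _ ⟨k, hk, rfl⟩
  exact scaling_mem_lipschitzVanishingOn hab hd hk

end Splines

section KernelComposition

variable {s : ℝ}

lemma singularKernel_mul {δ : ℝ} (hδ : 0 < δ) (u : ℝ) :
    singularKernel s (δ * u) = δ ^ (-s) * singularKernel s u := by
  rcases lt_or_ge 0 u with h | h
  · rw [singularKernel_of_pos h, singularKernel_of_pos (mul_pos hδ h), Real.mul_rpow hδ.le h.le]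
  · rw [singularKernel_of_nonpos h,
      singularKernel_of_nonpos (mul_nonpos_of_nonneg_of_nonpos hδ.le h), mul_zero]

lemma integrable_singularKernel_one_sub_mul (hs : s < 1) :
    Integrable fun v => singularKernel s (1 - v) * singularKernel s v := by
  have hbeta : IntegrableOn
      (fun x : ℝ => (x : ℂ) ^ (((1 - s : ℝ) : ℂ) - 1) * (1 - (x : ℂ)) ^ (((1 - s : ℝ) : ℂ) - 1))
      (Ioo 0 1) := by
    rw [← intervalIntegrable_iff_integrableOn_Ioo_of_le zero_le_one]
    exact Complex.betaIntegral_convergent (by simpa using hs) (by simpa using hs)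
  refine (IntegrableOn.integrable_indicator hbeta.norm measurableSet_Ioo).congr
    (ae_of_all _ fun v => ?_)
  dsimp only
  by_cases hv : v ∈ Ioo 0 1
  · have hv1 : 0 < 1 - v := sub_pos.2 hv.2
    rw [indicator_of_mem hv, singularKernel_of_pos hv.1, singularKernel_of_pos hv1, norm_mul,
      ← Complex.ofReal_one, ← Complex.ofReal_sub 1 v, Complex.norm_cpow_eq_rpow_re_of_pos hv.1,
      Complex.norm_cpow_eq_rpow_re_of_pos hv1, mul_comm]
    simp
  · rw [indicator_of_notMem hv]
    rcases le_or_gt v 0 with h | h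
    · rw [singularKernel_of_nonpos h, mul_zero]
    · rw [singularKernel_of_nonpos (u := 1 - v) (by linarith [not_lt.1 fun h' => hv ⟨h, h'⟩]),
        zero_mul]

lemma integrable_singularKernel_mul_add_one (hs : s < 1) (hs2 : 1 / 2 < s) :
    Integrable fun v => singularKernel s v * singularKernel s (v + 1) := by
  have hn := singularKernel_nonneg s
  have hnear : IntegrableOn (fun v => singularKernel s v * singularKernel s (v + 1)) (Ioc 0 1) := by
    refine (integrableOn_singularKernel hs 0 1).mono'
      (by fun_prop : Measurable _).aestronglyMeasurable ?_
    filter_upwards [ae_restrict_mem measurableSet_Ioc] with v hv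
    rw [Real.norm_of_nonneg (mul_nonneg (hn _) (hn _)),
      singularKernel_of_pos (by linarith [hv.1] : 0 < v + 1)]
    exact mul_le_of_le_one_right (hn v)
      (Real.rpow_le_one_of_one_le_of_nonpos (by linarith [hv.1]) (by linarith))
  have hfar : IntegrableOn (fun v => singularKernel s v * singularKernel s (v + 1)) (Ioi 1) := by
    refine (integrableOn_Ioi_rpow_of_lt (a := -s + -s) (by linarith) one_pos).mono'
      (by fun_prop : Measurable _).aestronglyMeasurable ?_
    filter_upwards [ae_restrict_mem measurableSet_Ioi] with v hv
    have hv0 : 0 < v := one_pos.trans hv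
    rw [Real.norm_of_nonneg (mul_nonneg (hn _) (hn _)), singularKernel_of_pos hv0,
      singularKernel_of_pos (by linarith : 0 < v + 1), Real.rpow_add hv0]
    exact mul_le_mul_of_nonneg_left
      (Real.rpow_le_rpow_of_nonpos hv0 (by linarith) (by linarith)) (Real.rpow_nonneg hv0.le _)
  refine (integrableOn_iff_integrable_of_support_subset fun v hv => ?_).1 (hnear.union hfar)
  rw [Ioc_union_Ioi_eq_Ioi zero_le_one]
  exact not_le.1 fun h : v ≤ 0 => hv (by simp only [singularKernel_of_nonpos h, zero_mul])

lemma integral_singularKernel_mul_add_one_pos (hs : s < 1) (hs2 : 1 / 2 < s) :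
    0 < ∫ v, singularKernel s v * singularKernel s (v + 1) := by
  have hn := singularKernel_nonneg s
  rw [integral_pos_iff_support_of_nonneg (fun v => mul_nonneg (hn _) (hn _))
    (integrable_singularKernel_mul_add_one hs hs2)]
  refine lt_of_lt_of_le (by simp) (measure_mono (s := Ioi (0 : ℝ)) fun v (hv : 0 < v) => ?_)
  rw [Function.mem_support, singularKernel_of_pos hv,
    singularKernel_of_pos (by linarith : 0 < v + 1)]
  positivity

lemma integral_comp_inv_mul_sub {E : Type*} [NormedAddCommGroup E] [NormedSpace ℝ E] (F : ℝ → E)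
    {δ : ℝ} (hδ : 0 < δ) (η : ℝ) : ∫ x, F (δ⁻¹ * (x - η)) = δ • ∫ v, F v := by
  rw [integral_sub_right_eq_self (fun x => F (δ⁻¹ * x)) η, Measure.integral_comp_mul_left,
    inv_inv, abs_of_pos hδ]

lemma singularKernel_sub_mul_singularKernel_sub {ξ η : ℝ} (h : η < ξ) (x : ℝ) :
    singularKernel s (ξ - x) * singularKernel s (x - η) = (ξ - η) ^ (-(2 * s)) *
      (singularKernel s (1 - (ξ - η)⁻¹ * (x - η)) * singularKernel s ((ξ - η)⁻¹ * (x - η))) := by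
  have hδ : 0 < ξ - η := sub_pos.2 h
  have hξ : ξ - x = (ξ - η) * (1 - (ξ - η)⁻¹ * (x - η)) := by field_simp; ring
  have hη : x - η = (ξ - η) * ((ξ - η)⁻¹ * (x - η)) := by field_simp
  rw [hξ, show singularKernel s (x - η) = _ from congrArg _ hη, singularKernel_mul hδ,
    singularKernel_mul hδ, show -(2 * s) = -s + -s by ring, Real.rpow_add hδ]
  ring

lemma singularKernel_sub_right_mul_singularKernel_sub_right {ξ η : ℝ} (h : η < ξ) (x : ℝ) :
    singularKernel s (η - x) * singularKernel s (ξ - x) = (ξ - η) ^ (-(2 * s)) *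
      (singularKernel s (-((ξ - η)⁻¹ * (x - η))) *
        singularKernel s (-((ξ - η)⁻¹ * (x - η)) + 1)) := by
  have hδ : 0 < ξ - η := sub_pos.2 h
  have hξ : ξ - x = (ξ - η) * (-((ξ - η)⁻¹ * (x - η)) + 1) := by field_simp; ring
  have hη : η - x = (ξ - η) * (-((ξ - η)⁻¹ * (x - η))) := by field_simp; ring
  rw [hξ, hη, singularKernel_mul hδ, singularKernel_mul hδ, show -(2 * s) = -s + -s by ring,
    Real.rpow_add hδ]
  ring_nf

lemma rpow_neg_two_mul_mul_self {δ : ℝ} (hδ : 0 < δ) (c : ℝ) :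
    δ ^ (-(2 * s)) * (δ * c) = c * singularKernel (2 * s - 1) δ := by
  rw [singularKernel_of_pos hδ, show -(2 * s - 1) = -(2 * s) + 1 by ring, Real.rpow_add hδ,
    Real.rpow_one]
  ring

lemma singularKernel_sub_mul_singularKernel_sub_of_le {ξ η : ℝ} (h : ξ ≤ η) (x : ℝ) :
    singularKernel s (ξ - x) * singularKernel s (x - η) = 0 := by
  rcases le_or_gt ξ x with hx | hx
  · rw [singularKernel_of_nonpos (sub_nonpos.2 hx), zero_mul]
  · rw [singularKernel_of_nonpos (u := x - η) (by linarith), mul_zero]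

lemma integrable_singularKernel_sub_mul (hs : s < 1) (ξ η : ℝ) :
    Integrable fun x => singularKernel s (ξ - x) * singularKernel s (x - η) := by
  rcases lt_or_ge η ξ with h | h
  · simp_rw [singularKernel_sub_mul_singularKernel_sub h]
    exact (((integrable_singularKernel_one_sub_mul hs).comp_mul_left'
      (inv_ne_zero (sub_pos.2 h).ne')).comp_sub_right η).const_mul _
  · simp_rw [singularKernel_sub_mul_singularKernel_sub_of_le h]
    exact integrable_zero _ _ _

lemma integral_singularKernel_sub_mul (s ξ η : ℝ) :
    ∫ x, singularKernel s (ξ - x) * singularKernel s (x - η) =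
      (∫ v, singularKernel s (1 - v) * singularKernel s v) *
        singularKernel (2 * s - 1) (ξ - η) := by
  rcases lt_or_ge η ξ with h | h
  · have hδ : 0 < ξ - η := sub_pos.2 h
    simp_rw [singularKernel_sub_mul_singularKernel_sub h]
    rw [integral_const_mul, integral_comp_inv_mul_sub
      (fun v => singularKernel s (1 - v) * singularKernel s v) hδ, smul_eq_mul,
      rpow_neg_two_mul_mul_self hδ]
  · simp_rw [singularKernel_sub_mul_singularKernel_sub_of_le h]
    rw [singularKernel_of_nonpos (sub_nonpos.2 h), integral_zero, mul_zero]

lemma integrable_singularKernel_sub_right_mul_of_lt (hs : s < 1) (hs2 : 1 / 2 < s) {ξ η : ℝ}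
    (h : η < ξ) : Integrable fun x => singularKernel s (η - x) * singularKernel s (ξ - x) := by
  simp_rw [singularKernel_sub_right_mul_singularKernel_sub_right h]
  exact (((integrable_singularKernel_mul_add_one hs hs2).comp_neg.comp_mul_left'
    (inv_ne_zero (sub_pos.2 h).ne')).comp_sub_right η).const_mul _

lemma integral_singularKernel_sub_right_mul_of_lt (s : ℝ) {ξ η : ℝ} (h : η < ξ) :
    ∫ x, singularKernel s (η - x) * singularKernel s (ξ - x) =
      (∫ v, singularKernel s v * singularKernel s (v + 1)) *
        singularKernel (2 * s - 1) (ξ - η) := by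
  have hδ : 0 < ξ - η := sub_pos.2 h
  simp_rw [singularKernel_sub_right_mul_singularKernel_sub_right h]
  rw [integral_const_mul, integral_comp_inv_mul_sub
    (fun v => singularKernel s (-v) * singularKernel s (-v + 1)) hδ,
    integral_neg_eq_self (fun v => singularKernel s v * singularKernel s (v + 1)), smul_eq_mul,
    rpow_neg_two_mul_mul_self hδ]

lemma integrable_singularKernel_sub_right_mul (hs : s < 1) (hs2 : 1 / 2 < s) {ξ η : ℝ}
    (h : ξ ≠ η) : Integrable fun x => singularKernel s (ξ - x) * singularKernel s (η - x) := by
  rcases lt_or_gt_of_ne h with h | h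
  · exact integrable_singularKernel_sub_right_mul_of_lt hs hs2 h
  · simpa only [mul_comm] using integrable_singularKernel_sub_right_mul_of_lt hs hs2 h

lemma integral_singularKernel_sub_right_mul (s : ℝ) {ξ η : ℝ} (h : ξ ≠ η) :
    ∫ x, singularKernel s (ξ - x) * singularKernel s (η - x) =
      (∫ v, singularKernel s v * singularKernel s (v + 1)) *
        (singularKernel (2 * s - 1) (ξ - η) + singularKernel (2 * s - 1) (η - ξ)) := by
  rcases lt_or_gt_of_ne h with h | h
  · rw [integral_singularKernel_sub_right_mul_of_lt s h,
      singularKernel_of_nonpos (u := ξ - η) (by linarith), zero_add]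
  · simp_rw [mul_comm (singularKernel s (ξ - _))]
    rw [integral_singularKernel_sub_right_mul_of_lt s h,
      singularKernel_of_nonpos (u := η - ξ) (by linarith), add_zero]

end KernelComposition

section PositiveDefinite

variable {𝕜 : Type*} [RCLike 𝕜]

section Transforms

variable {X Y : Type*} [MeasurableSpace X] [MeasurableSpace Y] {μ : Measure X} {ν : Measure Y}
  [SFinite μ] {A B : X → Y → ℝ} {w : Y → 𝕜} {N : Y × Y → ℝ}

lemma integrable_mul_smul_mul_conj (hA : Measurable (Function.uncurry A))
    (hB : Measurable (Function.uncurry B)) (hA0 : ∀ x ξ, 0 ≤ A x ξ) (hB0 : ∀ x ξ, 0 ≤ B x ξ)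
    (hw : AEStronglyMeasurable w ν)
    (hAB : ∀ᵐ p ∂(ν.prod ν), Integrable (fun x => A x p.1 * B x p.2) μ)
    (hN : ∀ᵐ p ∂(ν.prod ν), ∫ x, A x p.1 * B x p.2 ∂μ = N p)
    (hint : Integrable (fun p => N p • (w p.1 * conj (w p.2))) (ν.prod ν)) :
    Integrable (fun z : (Y × Y) × X => (A z.2 z.1.1 * B z.2 z.1.2) • (w z.1.1 * conj (w z.1.2)))
      ((ν.prod ν).prod μ) := by
  have hkernel : Measurable fun z : (Y × Y) × X => A z.2 z.1.1 * B z.2 z.1.2 :=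
    (hA.comp (measurable_snd.prodMk (measurable_fst.comp measurable_fst))).mul
      (hB.comp (measurable_snd.prodMk (measurable_snd.comp measurable_fst)))
  have hww : AEStronglyMeasurable (fun p : Y × Y => w p.1 * conj (w p.2)) (ν.prod ν) :=
    hw.comp_fst.mul (RCLike.continuous_conj.comp_aestronglyMeasurable hw.comp_snd)
  have hmeas : AEStronglyMeasurable (fun z : (Y × Y) × X =>
      (A z.2 z.1.1 * B z.2 z.1.2) • (w z.1.1 * conj (w z.1.2))) ((ν.prod ν).prod μ) :=
    hkernel.aestronglyMeasurable.smul hww.comp_fst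
  rw [integrable_prod_iff hmeas]
  refine ⟨by filter_upwards [hAB] with p hp using hp.smul_const _, hint.norm.congr ?_⟩
  have h0 (x : X) (p : Y × Y) : 0 ≤ A x p.1 * B x p.2 := mul_nonneg (hA0 _ _) (hB0 _ _)
  filter_upwards [hN] with p hp
  have hN0 : 0 ≤ N p := hp ▸ integral_nonneg fun x => h0 x p
  simp_rw [norm_smul, Real.norm_of_nonneg hN0, Real.norm_of_nonneg (h0 _ p)]
  rw [integral_mul_const, hp]

variable [SFinite ν]

lemma integral_transform_mul_conj_transform (hA : Measurable (Function.uncurry A))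
    (hB : Measurable (Function.uncurry B)) (hA0 : ∀ x ξ, 0 ≤ A x ξ) (hB0 : ∀ x ξ, 0 ≤ B x ξ)
    (hw : AEStronglyMeasurable w ν)
    (hAB : ∀ᵐ p ∂(ν.prod ν), Integrable (fun x => A x p.1 * B x p.2) μ)
    (hN : ∀ᵐ p ∂(ν.prod ν), ∫ x, A x p.1 * B x p.2 ∂μ = N p)
    (hint : Integrable (fun p => N p • (w p.1 * conj (w p.2))) (ν.prod ν)) :
    ∫ x, (∫ ξ, A x ξ • w ξ ∂ν) * conj (∫ η, B x η • w η ∂ν) ∂μ =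
      ∫ p, N p • (w p.1 * conj (w p.2)) ∂(ν.prod ν) := by
  have hprod (x : X) : (∫ ξ, A x ξ • w ξ ∂ν) * conj (∫ η, B x η • w η ∂ν) =
      ∫ p, (A x p.1 * B x p.2) • (w p.1 * conj (w p.2)) ∂(ν.prod ν) := by
    rw [← integral_conj, ← integral_prod_mul]
    refine integral_congr_ae (ae_of_all _ fun p => ?_)
    simp only [RCLike.real_smul_eq_coe_mul, map_mul, RCLike.conj_ofReal]
    ring
  simp_rw [hprod]
  rw [← integral_integral_swap
    (integrable_mul_smul_mul_conj hA hB hA0 hB0 hw hAB hN hint)]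
  refine integral_congr_ae ?_
  filter_upwards [hN] with p hp
  rw [integral_smul_const, hp]

end Transforms

lemma ae_prod_fst_ne_snd (ν : Measure ℝ) [SFinite ν] [NullSingletonClass ν] :
    ∀ᵐ p ∂(ν.prod ν), p.1 ≠ p.2 := by
  rw [Measure.ae_prod_iff_ae_ae
    (measurableSet_eq_fun measurable_fst measurable_snd).compl (p := fun p => p.1 ≠ p.2)]
  exact ae_of_all _ fun x => (ae_iff.2 (by simp) : ∀ᵐ y ∂ν, x ≠ y)

variable {a b s C : ℝ} {w : ℝ → 𝕜}

lemma integrable_singularKernel_sub_smul_mul_conj (hs : s < 1)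
    (hw : AEStronglyMeasurable w (volume.restrict (Ioc a b)))
    (hC : ∀ᵐ x ∂(volume.restrict (Ioc a b)), ‖w x‖ ≤ C) :
    Integrable (fun p : ℝ × ℝ => singularKernel s (p.1 - p.2) • (w p.1 * conj (w p.2)))
      ((volume.restrict (Ioc a b)).prod (volume.restrict (Ioc a b))) := by
  have hwconj : IntegrableOn (fun x => conj (w x)) (Ioc a b) :=
    Integrable.of_bound (RCLike.continuous_conj.comp_aestronglyMeasurable hw) C
      (by simpa only [RCLike.norm_conj] using hC)
  refine ((integrable_singularKernel_sub_smul hs hwconj).bdd_mul hw.comp_fst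
    (Measure.quasiMeasurePreserving_fst.ae hC)).congr (ae_of_all _ fun p => ?_)
  exact mul_smul_comm _ _ _

/-- The Hermitian form of the kernel `(ξ - η)_+^{-s}` on the functions on `(a, b]`. -/
noncomputable def singularKernelForm (s a b : ℝ) (w : ℝ → 𝕜) : 𝕜 :=
  ∫ p : ℝ × ℝ, singularKernel s (p.1 - p.2) • (w p.1 * conj (w p.2))
    ∂((volume.restrict (Ioc a b)).prod (volume.restrict (Ioc a b)))

/-- The left fractional integral of order `1 - s` over `(a, b]`, without the factor
`1 / Γ(1 - s)`. -/
noncomputable def leftSingularIntegral {E : Type*} [NormedAddCommGroup E] [NormedSpace ℝ E]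
    (s a b : ℝ) (w : ℝ → E) (x : ℝ) : E :=
  ∫ ξ in Ioc a b, singularKernel s (x - ξ) • w ξ

/-- The right fractional integral of order `1 - s` over `(a, b]`, without the factor
`1 / Γ(1 - s)`. -/
noncomputable def rightSingularIntegral {E : Type*} [NormedAddCommGroup E] [NormedSpace ℝ E]
    (s a b : ℝ) (w : ℝ → E) (x : ℝ) : E :=
  ∫ ξ in Ioc a b, singularKernel s (ξ - x) • w ξ

lemma conj_singularKernelForm (s a b : ℝ) (w : ℝ → 𝕜) :
    conj (singularKernelForm s a b w) =
      ∫ p : ℝ × ℝ, singularKernel s (p.2 - p.1) • (w p.1 * conj (w p.2))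
        ∂((volume.restrict (Ioc a b)).prod (volume.restrict (Ioc a b))) := by
  rw [singularKernelForm, ← integral_conj, ← integral_prod_swap]
  refine integral_congr_ae (ae_of_all _ fun p => ?_)
  simp only [Prod.fst_swap, Prod.snd_swap, RCLike.conj_smul, map_mul, RCLike.conj_conj]
  rw [mul_comm]

lemma integral_rightSingularIntegral_mul_conj_left (hs : s < 1)
    (hw : AEStronglyMeasurable w (volume.restrict (Ioc a b)))
    (hC : ∀ᵐ x ∂(volume.restrict (Ioc a b)), ‖w x‖ ≤ C) :
    ∫ x, rightSingularIntegral s a b w x * conj (leftSingularIntegral s a b w x) =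
      (∫ v, singularKernel s (1 - v) * singularKernel s v) •
        singularKernelForm (2 * s - 1) a b w := by
  have hform := integrable_singularKernel_sub_smul_mul_conj (s := 2 * s - 1) (by linarith) hw hC
  rw [singularKernelForm, ← integral_smul]
  simp_rw [smul_smul]
  refine integral_transform_mul_conj_transform (A := fun x ξ => singularKernel s (ξ - x))
    (B := fun x ξ => singularKernel s (x - ξ)) (by unfold Function.uncurry; fun_prop)
    (by unfold Function.uncurry; fun_prop) (fun _ _ => singularKernel_nonneg _ _)
    (fun _ _ => singularKernel_nonneg _ _) hw
    (ae_of_all _ fun p => integrable_singularKernel_sub_mul hs p.1 p.2)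
    (ae_of_all _ fun p => integral_singularKernel_sub_mul s p.1 p.2) ?_
  simp_rw [mul_smul]
  exact hform.smul (∫ v, singularKernel s (1 - v) * singularKernel s v)

lemma integral_rightSingularIntegral_mul_conj_self (hs : s < 1) (hs2 : 1 / 2 < s)
    (hw : AEStronglyMeasurable w (volume.restrict (Ioc a b)))
    (hC : ∀ᵐ x ∂(volume.restrict (Ioc a b)), ‖w x‖ ≤ C) :
    ∫ x, rightSingularIntegral s a b w x * conj (rightSingularIntegral s a b w x) =
      (∫ v, singularKernel s v * singularKernel s (v + 1)) •
        (singularKernelForm (2 * s - 1) a b w + conj (singularKernelForm (2 * s - 1) a b w)) := by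
  set c := ∫ v, singularKernel s v * singularKernel s (v + 1)
  set ν := volume.restrict (Ioc a b)
  have hform := integrable_singularKernel_sub_smul_mul_conj (s := 2 * s - 1) (by linarith) hw hC
  have hform' : Integrable (fun p : ℝ × ℝ =>
      singularKernel (2 * s - 1) (p.2 - p.1) • (w p.1 * conj (w p.2))) (ν.prod ν) := by
    refine (RCLike.conjCLE.toContinuousLinearMap.integrable_comp hform.swap).congr
      (ae_of_all _ fun p => ?_)
    simp [mul_comm]
  have hmeas : Measurable (Function.uncurry fun x ξ : ℝ => singularKernel s (ξ - x)) := by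
    unfold Function.uncurry; fun_prop
  have hsplit (p : ℝ × ℝ) : (c * (singularKernel (2 * s - 1) (p.1 - p.2) +
      singularKernel (2 * s - 1) (p.2 - p.1))) • (w p.1 * conj (w p.2)) =
      c • (singularKernel (2 * s - 1) (p.1 - p.2) • (w p.1 * conj (w p.2)) +
        singularKernel (2 * s - 1) (p.2 - p.1) • (w p.1 * conj (w p.2))) := by
    rw [mul_smul, add_smul]
  rw [conj_singularKernelForm, singularKernelForm, ← integral_add hform hform', ← integral_smul]
  simp_rw [← hsplit]
  refine integral_transform_mul_conj_transform hmeas hmeas (fun _ _ => singularKernel_nonneg _ _)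
    (fun _ _ => singularKernel_nonneg _ _) hw
    ((ae_prod_fst_ne_snd ν).mono fun p hp => integrable_singularKernel_sub_right_mul hs hs2 hp)
    ((ae_prod_fst_ne_snd ν).mono fun p hp => integral_singularKernel_sub_right_mul s hp) ?_
  simp_rw [hsplit]
  exact (hform.add hform').smul c

lemma re_singularKernelForm_nonneg (hs : s < 1) (hs2 : 1 / 2 < s)
    (hw : AEStronglyMeasurable w (volume.restrict (Ioc a b)))
    (hC : ∀ᵐ x ∂(volume.restrict (Ioc a b)), ‖w x‖ ≤ C) :
    0 ≤ RCLike.re (singularKernelForm (2 * s - 1) a b w) := by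
  have hc := integral_singularKernel_mul_add_one_pos hs hs2
  have h := congrArg RCLike.re (integral_rightSingularIntegral_mul_conj_self hs hs2 hw hC)
  simp_rw [RCLike.mul_conj, ← RCLike.ofReal_pow, RCLike.add_conj] at h
  rw [integral_ofReal, RCLike.ofReal_re, RCLike.smul_re, ← RCLike.ofReal_ofNat,
    ← RCLike.ofReal_mul, RCLike.ofReal_re] at h
  have : 0 ≤ 2 * RCLike.re (singularKernelForm (2 * s - 1) a b w) :=
    nonneg_of_mul_nonneg_right (h ▸ integral_nonneg fun _ => sq_nonneg _) hc
  linarith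

lemma re_integral_rightSingularIntegral_mul_conj_left_nonneg (hs : s < 1) (hs2 : 1 / 2 < s)
    (hw : AEStronglyMeasurable w (volume.restrict (Ioc a b)))
    (hC : ∀ᵐ x ∂(volume.restrict (Ioc a b)), ‖w x‖ ≤ C) :
    0 ≤ RCLike.re
      (∫ x, rightSingularIntegral s a b w x * conj (leftSingularIntegral s a b w x)) := by
  rw [integral_rightSingularIntegral_mul_conj_left hs hw hC, RCLike.smul_re]
  exact mul_nonneg (integral_nonneg fun v =>
    mul_nonneg (singularKernel_nonneg _ _) (singularKernel_nonneg _ _))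
    (re_singularKernelForm_nonneg hs hs2 hw hC)

end PositiveDefinite

section RiemannLiouville

section Primitive

variable {E : Type*} [NormedAddCommGroup E] [NormedSpace ℝ E] {a b s y : ℝ} {u w : ℝ → E}

lemma integral_indicator_Ioc_comp_sub (w : ℝ → E) {v : ℝ} (hv : v ∈ Ioc 0 (y - a)) (hyb : y ≤ b) :
    ∫ z in Ioc a y, (Ioc a b).indicator w (z - v) = ∫ ξ in a..(y - v), w ξ := by
  have hsub : Ioc a (y - v) ⊆ Ioc (a - v) (y - v) := Ioc_subset_Ioc_left (by linarith [hv.1])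
  rw [← intervalIntegral.integral_of_le (by linarith [hv.1, hv.2]),
    intervalIntegral.integral_comp_sub_right (fun z => (Ioc a b).indicator w z),
    intervalIntegral.integral_of_le (by linarith [hv.1, hv.2]),
    intervalIntegral.integral_of_le (by linarith [hv.2]),
    setIntegral_indicator measurableSet_Ioc]
  congr 2
  ext ξ
  exact ⟨fun h => ⟨h.2.1, h.1.2⟩, fun h => ⟨hsub h, h.1, by linarith [h.2, hv.1]⟩⟩

lemma setIntegral_rpow_smul_indicator_comp_sub (s : ℝ) (w : ℝ → E) {z : ℝ} (hzy : z ≤ y) :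
    ∫ v in Ioc 0 (y - a), (v ^ (-s) : ℝ) • (Ioc a b).indicator w (z - v) =
      leftSingularIntegral s a b w z := by
  have hext : ∫ v in Ioc 0 (y - a), (v ^ (-s) : ℝ) • (Ioc a b).indicator w (z - v) =
      ∫ v, singularKernel s v • (Ioc a b).indicator w (z - v) := by
    rw [← integral_indicator measurableSet_Ioc]
    refine integral_congr_ae (ae_of_all _ fun v => ?_)
    dsimp only
    by_cases hv : v ∈ Ioc 0 (y - a)
    · rw [indicator_of_mem hv, singularKernel_of_pos hv.1]
    · rw [indicator_of_notMem hv]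
      rcases le_or_gt v 0 with h0 | h0
      · rw [singularKernel_of_nonpos h0, zero_smul]
      · rw [indicator_of_notMem fun h : z - v ∈ Ioc a b => hv ⟨h0, by linarith [h.1]⟩, smul_zero]
  rw [hext, ← integral_sub_left_eq_self _ volume z, leftSingularIntegral,
    ← integral_indicator measurableSet_Ioc]
  simp only [sub_sub_cancel, indicator_smul]

/-- Both sides are the double integral of `v^{-s} w(z - v)`. -/
lemma integral_rpow_sub_smul_primitive (hs : s < 1) (hw : IntegrableOn w (Ioc a b))
    (hu : ∀ x ∈ Icc a b, u x = ∫ ξ in a..x, w ξ) (hy : y ∈ Icc a b) :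
    ∫ ξ in a..y, ((y - ξ) ^ (-s) : ℝ) • u ξ = ∫ z in a..y, leftSingularIntegral s a b w z := by
  have hya : 0 ≤ y - a := sub_nonneg.2 hy.1
  have hpow : IntegrableOn (fun v : ℝ => v ^ (-s)) (Ioc 0 (y - a)) :=
    (intervalIntegrable_iff_integrableOn_Ioc_of_le hya).1
      (intervalIntegral.intervalIntegrable_rpow' (by linarith))
  have hint : Integrable (fun p : ℝ × ℝ => (p.2 ^ (-s) : ℝ) • (Ioc a b).indicator w (p.1 - p.2))
      ((volume.restrict (Ioc a y)).prod (volume.restrict (Ioc 0 (y - a)))) :=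
    (hpow.convolution_integrand (ContinuousLinearMap.lsmul ℝ ℝ)
      (hw.integrable_indicator measurableSet_Ioc)).mono_measure
        (Measure.prod_mono Measure.restrict_le_self le_rfl)
  have hsubst : ∫ ξ in a..y, ((y - ξ) ^ (-s) : ℝ) • u ξ =
      ∫ v in Ioc 0 (y - a), (v ^ (-s) : ℝ) • u (y - v) := by
    have h := intervalIntegral.integral_comp_sub_left
      (fun v => (v ^ (-s) : ℝ) • u (y - v)) y (a := a) (b := y)
    simp only [sub_sub_cancel, sub_self] at h
    rw [h, intervalIntegral.integral_of_le hya]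
  calc ∫ ξ in a..y, ((y - ξ) ^ (-s) : ℝ) • u ξ
      = ∫ v in Ioc 0 (y - a), ∫ z in Ioc a y, (v ^ (-s) : ℝ) • (Ioc a b).indicator w (z - v) := by
        rw [hsubst]
        refine setIntegral_congr_fun measurableSet_Ioc fun v hv => ?_
        rw [hu (y - v) ⟨by linarith [hv.2], by linarith [hv.1, hy.2]⟩, integral_smul,
          integral_indicator_Ioc_comp_sub w hv hy.2]
    _ = ∫ z in Ioc a y, ∫ v in Ioc 0 (y - a), (v ^ (-s) : ℝ) • (Ioc a b).indicator w (z - v) :=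
        (integral_integral_swap hint).symm
    _ = ∫ z in a..y, leftSingularIntegral s a b w z := by
        rw [intervalIntegral.integral_of_le hy.1]
        exact setIntegral_congr_fun measurableSet_Ioc fun z hz =>
          setIntegral_rpow_smul_indicator_comp_sub s w hz.2

end Primitive

variable {a b s : ℝ} {u : ℝ → ℂ}

lemma ae_leftRL_eq (hs : s < 1) (hab : a ≤ b) (hu : AbsolutelyContinuousOnInterval u a b)
    (hua : u a = 0) : ∀ᵐ x : ℝ, x ∈ Ioo a b →
      leftRL a s u x = (Real.Gamma (1 - s))⁻¹ • leftSingularIntegral s a b (deriv u) x := by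
  have hderiv : IntegrableOn (deriv u) (Ioc a b) :=
    (intervalIntegrable_iff_integrableOn_Ioc_of_le hab).1
      (intervalIntegrable_deriv_of_absolutelyContinuousOnInterval hu)
  have hint : IntervalIntegrable (leftSingularIntegral s a b (deriv u)) volume a b :=
    (intervalIntegrable_iff_integrableOn_Ioc_of_le hab).2
      (integrable_singularKernel_sub_smul hs hderiv).integral_prod_left
  have hprim : ∀ z ∈ Icc a b, u z = ∫ ξ in a..z, deriv u ξ := fun z hz => by
    have hsub : uIcc a z ⊆ uIcc a b := by
      rw [uIcc_of_le hab, uIcc_of_le hz.1]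
      exact Icc_subset_Icc_right hz.2
    rw [integral_deriv_of_absolutelyContinuousOnInterval (hu.mono hsub), hua, sub_zero]
  filter_upwards [hint.ae_hasDerivAt_integral] with x hx hxm
  have hev : (fun y : ℝ => ∫ ξ in a..y, ((y - ξ) ^ (-s) : ℝ) • u ξ) =ᶠ[𝓝 x]
      fun y => ∫ z in a..y, leftSingularIntegral s a b (deriv u) z := by
    filter_upwards [Ioo_mem_nhds hxm.1 hxm.2] with y hy
    exact integral_rpow_sub_smul_primitive hs hderiv hprim (Ioo_subset_Icc_self hy)
  rw [leftRL, hev.deriv_eq,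
    (hx (by rw [uIcc_of_le hab]; exact Ioo_subset_Icc_self hxm) a left_mem_uIcc).deriv]

lemma rightRL_eq_leftRL_reflect (a b s : ℝ) (u : ℝ → ℂ) (x : ℝ) :
    rightRL b s u x = leftRL a s (fun x => u (a + b - x)) (a + b - x) := by
  have h (y : ℝ) : ∫ ξ in y..b, ((ξ - y) ^ (-s) : ℝ) • u ξ =
      (fun y : ℝ => ∫ ξ in a..y, ((y - ξ) ^ (-s) : ℝ) • u (a + b - ξ)) (a + b - y) := by
    have hsubst := intervalIntegral.integral_comp_sub_left
      (fun ζ => ((ζ - y) ^ (-s) : ℝ) • u ζ) (a + b) (a := a) (b := a + b - y)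
    simp only [sub_sub_cancel, add_sub_cancel_left] at hsubst
    rw [← hsubst]
    refine intervalIntegral.integral_congr fun ξ _ => ?_
    congr 2
    ring
  rw [rightRL, leftRL, funext h, deriv_comp_const_sub
    (f := fun y : ℝ => ∫ ξ in a..y, ((y - ξ) ^ (-s) : ℝ) • u (a + b - ξ)),
    smul_neg, neg_smul, neg_neg]

lemma leftSingularIntegral_deriv_reflect (hab : a ≤ b) (s : ℝ) (u : ℝ → ℂ) (x : ℝ) :
    leftSingularIntegral s a b (deriv fun x => u (a + b - x)) (a + b - x) =
      -rightSingularIntegral s a b (deriv u) x := by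
  have hsubst := intervalIntegral.integral_comp_sub_left
    (fun ζ => singularKernel s (ζ - x) • deriv u ζ) (a + b) (a := a) (b := b)
  simp only [add_sub_cancel_left, add_sub_cancel_right] at hsubst
  rw [leftSingularIntegral, rightSingularIntegral, ← intervalIntegral.integral_of_le hab,
    ← intervalIntegral.integral_of_le hab, ← hsubst, ← intervalIntegral.integral_neg]
  refine intervalIntegral.integral_congr fun ξ _ => ?_
  simp only [deriv_comp_const_sub, smul_neg]
  congr 3
  ring

lemma ae_rightRL_eq (hs : s < 1) (hab : a ≤ b) (hu : AbsolutelyContinuousOnInterval u a b)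
    (hub : u b = 0) : ∀ᵐ x : ℝ, x ∈ Ioo a b →
      rightRL b s u x = -((Real.Gamma (1 - s))⁻¹ • rightSingularIntegral s a b (deriv u) x) := by
  have h := ae_leftRL_eq hs hab (absolutelyContinuousOnInterval_reflect hu) (by simpa using hub)
  filter_upwards [(Measure.measurePreserving_sub_left volume (a + b)).quasiMeasurePreserving.ae h]
    with x hx hxm
  rw [rightRL_eq_leftRL_reflect a, hx ⟨by linarith [hxm.2], by linarith [hxm.1]⟩,
    leftSingularIntegral_deriv_reflect hab, smul_neg]

end RiemannLiouville

section RieszForm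

variable {a b s α : ℝ} {u : ℝ → ℂ}

lemma l2Inner_conj (a b : ℝ) (u v : ℝ → ℂ) : conj (l2Inner a b v u) = l2Inner a b u v := by
  rw [l2Inner, l2Inner, ← integral_conj]
  simp [mul_comm]

lemma singularIntegral_mul_conj_eq_zero {w : ℝ → ℂ} {x : ℝ} (hx : x ∉ Ioo a b) :
    rightSingularIntegral s a b w x * conj (leftSingularIntegral s a b w x) = 0 := by
  rcases le_or_gt x a with h | h
  · have : leftSingularIntegral s a b w x = 0 :=
      setIntegral_eq_zero_of_forall_eq_zero fun ξ hξ => by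
        rw [singularKernel_of_nonpos (by linarith [hξ.1]), zero_smul]
    rw [this, map_zero, mul_zero]
  · have hbx : b ≤ x := not_lt.1 fun h' => hx ⟨h, h'⟩
    have : rightSingularIntegral s a b w x = 0 :=
      setIntegral_eq_zero_of_forall_eq_zero fun ξ hξ => by
        rw [singularKernel_of_nonpos (by linarith [hξ.2]), zero_smul]
    rw [this, zero_mul]

lemma l2Inner_rightRL_leftRL (hs : s < 1) (hab : a ≤ b)
    (hu : AbsolutelyContinuousOnInterval u a b) (hua : u a = 0) (hub : u b = 0) :
    l2Inner a b (rightRL b s u) (leftRL a s u) =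
      -((Real.Gamma (1 - s))⁻¹ ^ 2) • ∫ x, rightSingularIntegral s a b (deriv u) x *
        conj (leftSingularIntegral s a b (deriv u) x) := by
  rw [l2Inner, ← integral_smul, ← integral_indicator measurableSet_Ioo]
  refine integral_congr_ae ?_
  filter_upwards [ae_leftRL_eq hs hab hu hua, ae_rightRL_eq hs hab hu hub] with x hleft hright
  by_cases hx : x ∈ Ioo a b
  · rw [indicator_of_mem hx, hleft hx, hright hx]
    simp only [Complex.real_smul, map_mul, Complex.conj_ofReal]
    push_cast
    ring
  · rw [indicator_of_notMem hx, singularIntegral_mul_conj_eq_zero hx, smul_zero]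

lemma re_l2Inner_rightRL_leftRL_nonpos (hs : s < 1) (hs2 : 1 / 2 < s) (hab : a ≤ b)
    (hu : u ∈ lipschitzVanishingOn ℂ (Icc a b) {a, b}) :
    (l2Inner a b (rightRL b s u) (leftRL a s u)).re ≤ 0 := by
  obtain ⟨⟨C, hlip⟩, hzero⟩ := hu
  have hac : AbsolutelyContinuousOnInterval u a b :=
    LipschitzOnWith.absolutelyContinuousOnInterval (by rwa [uIcc_of_le hab])
  have hC : ∀ᵐ x ∂(volume.restrict (Ioc a b)), ‖deriv u x‖ ≤ C := by
    rw [← restrict_Ioo_eq_restrict_Ioc]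
    filter_upwards [ae_restrict_mem measurableSet_Ioo] with x hx
    exact norm_deriv_le_of_lipschitzOn (Icc_mem_nhds hx.1 hx.2) hlip
  have hpos := re_integral_rightSingularIntegral_mul_conj_left_nonneg hs hs2
    (measurable_deriv u).aestronglyMeasurable hC
  rw [l2Inner_rightRL_leftRL hs hab hac (hzero (by simp)) (hzero (by simp)), Complex.smul_re,
    smul_eq_mul]
  exact mul_nonpos_of_nonpos_of_nonneg (neg_nonpos.2 (sq_nonneg _)) hpos

lemma re_rieszForm_self_nonneg (hab : a ≤ b) (hα : 1 < α) (hα2 : α < 2)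
    (hu : u ∈ lipschitzVanishingOn ℂ (Icc a b) {a, b}) : 0 ≤ (rieszForm a b α u u).re := by
  have h := re_l2Inner_rightRL_leftRL_nonpos (s := α / 2) (by linarith) (by linarith) hab hu
  have hcos : Real.cos (α * Real.pi / 2) < 0 := by
    refine Real.cos_neg_of_pi_div_two_lt_of_lt ?_ ?_ <;> nlinarith [Real.pi_pos]
  rw [rieszForm, ← l2Inner_conj a b (leftRL a (α / 2) u), Complex.div_ofReal_re, Complex.add_re,
    Complex.conj_re]
  exact div_nonneg_of_nonpos (by linarith) (by linarith)

end RieszForm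

section Separated

lemma substantialIntegral_eq_setIntegral {γ T t : ℝ} (ht : t ∈ Icc 0 T) (q : ℂ) {y e : ℝ → ℂ}
    (he : ∀ᵐ s : ℝ, s ∈ Ioo 0 T → deriv y s + q * y s = e s) :
    substantialIntegral γ q y t = ∫ s in Ioc 0 T, singularKernel γ (t - s) •
      (Complex.exp (q * ((s - t : ℝ) : ℂ)) * e s) := by
  rw [setIntegral_singularKernel_sub_smul γ ht, substantialIntegral,
    ← intervalIntegral.integral_const_mul]
  refine intervalIntegral.integral_congr_ae ?_
  filter_upwards [he, Measure.ae_ne volume T] with s h hs hst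
  rw [uIoc_of_le ht.1] at hst
  have hexp : Complex.exp (q * ((s - t : ℝ) : ℂ)) =
      Complex.exp (-(q * t)) * Complex.exp (q * s) := by
    rw [← Complex.exp_add]
    congr 1
    push_cast
    ring
  rw [← h ⟨hst.1, lt_of_le_of_ne (hst.2.trans ht.2) hs⟩, hexp, Complex.real_smul,
    Complex.real_smul]
  ring

variable {X ι : Type*} [MeasurableSpace X] {ν : Measure X} {γ T τ : ℝ} {q : X → ℂ}

lemma integrable_singularKernel_smul_exp_mul (hγ1 : γ < 1)
    (hq : AEStronglyMeasurable q ν) (hq0 : ∀ᵐ x ∂ν, 0 ≤ (q x).re) {h : ℝ → ℂ} {m : X → ℂ}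
    (hh : IntegrableOn h (Ioc 0 T)) (hm : Integrable m ν) :
    Integrable (fun z : (X × ℝ) × ℝ => singularKernel γ (z.1.2 - z.2) •
        (Complex.exp (q z.1.1 * ((z.2 - z.1.2 : ℝ) : ℂ)) * (h z.2 * m z.1.1)))
      ((ν.prod (volume.restrict (Ioc 0 T))).prod (volume.restrict (Ioc 0 T))) := by
  have hmaj : Integrable (fun z : (X × ℝ) × ℝ => m z.1.1 * singularKernel γ (z.1.2 - z.2) • h z.2)
      ((ν.prod (volume.restrict (Ioc 0 T))).prod (volume.restrict (Ioc 0 T))) :=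
    (measurePreserving_prodAssoc ν (volume.restrict (Ioc 0 T))
      (volume.restrict (Ioc 0 T))).integrable_comp_of_integrable
      (hm.mul_prod (integrable_singularKernel_sub_smul hγ1 hh))
  have hker : Measurable fun z : (X × ℝ) × ℝ => singularKernel γ (z.1.2 - z.2) := by fun_prop
  have hexp : Measurable fun z : (X × ℝ) × ℝ => ((z.2 - z.1.2 : ℝ) : ℂ) := by fun_prop
  refine hmaj.mono (hker.aestronglyMeasurable.smul
    ((Complex.continuous_exp.comp_aestronglyMeasurable
      (hq.comp_fst.comp_fst.mul hexp.aestronglyMeasurable)).mul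
        (hh.1.comp_snd.mul hm.1.comp_fst.comp_fst))) ?_
  filter_upwards [Measure.quasiMeasurePreserving_fst.ae
    (Measure.quasiMeasurePreserving_fst.ae hq0)] with z hz
  rcases le_or_gt z.1.2 z.2 with hle | hlt
  · simp [singularKernel_of_nonpos (sub_nonpos.2 hle)]
  · have hdamp : ‖Complex.exp (q z.1.1 * ((z.2 - z.1.2 : ℝ) : ℂ))‖ ≤ 1 := by
      rw [Complex.norm_exp, Real.exp_le_one_iff, Complex.re_mul_ofReal]
      exact mul_nonpos_of_nonneg_of_nonpos hz (by linarith)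
    calc _ = ‖Complex.exp (q z.1.1 * ((z.2 - z.1.2 : ℝ) : ℂ))‖ *
          ‖m z.1.1 * singularKernel γ (z.1.2 - z.2) • h z.2‖ := by
          simp only [norm_smul, norm_mul]
          ring
      _ ≤ _ := mul_le_of_le_one_left (norm_nonneg _) hdamp

/-- `G(t, x) = ∑ c_k(t) φ_k(x)` for `t ∈ [0, T]`, with absolutely continuous coefficients `c_k` and
essentially bounded functions `φ_k` of the position, as in a Galerkin semi-discretization. -/
structure IsSeparated (T : ℝ) (ν : Measure X) (I : Finset ι) (c : ι → ℝ → ℂ) (φ : ι → X → ℂ)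
    (G : ℝ → X → ℂ) : Prop where
  coeff : ∀ k ∈ I, AbsolutelyContinuousOnInterval (c k) 0 T
  memLp_basis : ∀ k ∈ I, MemLp (φ k) ⊤ ν
  eq_sum : ∀ t ∈ Icc 0 T, ∀ x, G t x = ∑ k ∈ I, c k t * φ k x

namespace IsSeparated

variable {I : Finset ι} {c : ι → ℝ → ℂ} {φ : ι → X → ℂ} {G : ℝ → X → ℂ}

lemma absolutelyContinuousOnInterval (hG : IsSeparated T ν I c φ G) (hT : 0 ≤ T) (x : X) :
    AbsolutelyContinuousOnInterval (fun t => G t x) 0 T := by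
  refine absolutelyContinuousOnInterval_congr (absolutelyContinuousOnInterval_sum fun k hk =>
    (hG.coeff k hk).const_smul (φ k x)) fun t ht => ?_
  rw [uIcc_of_le hT] at ht
  simp [hG.eq_sum t ht x, mul_comm]

lemma mono (hG : IsSeparated T ν I c φ G) (hτ : τ ∈ Icc 0 T) : IsSeparated τ ν I c φ G where
  coeff k hk := (hG.coeff k hk).mono <| by
    rw [uIcc_of_le hτ.1, uIcc_of_le (hτ.1.trans hτ.2)]
    exact Icc_subset_Icc_right hτ.2
  memLp_basis := hG.memLp_basis
  eq_sum t ht := hG.eq_sum t ⟨ht.1, ht.2.trans hτ.2⟩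

lemma ae_deriv_eq (hG : IsSeparated T ν I c φ G) :
    ∀ᵐ s : ℝ, s ∈ Ioo 0 T → ∀ x, deriv (fun t => G t x) s = ∑ k ∈ I, deriv (c k) s * φ k x := by
  have hdiff : ∀ᵐ s : ℝ, ∀ k ∈ I, s ∈ uIcc 0 T → DifferentiableAt ℝ (c k) s :=
    (Finset.eventually_all I).2 fun k hk =>
      ae_differentiableAt_of_absolutelyContinuousOnInterval (hG.coeff k hk)
  filter_upwards [hdiff] with s hs hsT x
  have hev : (fun t => G t x) =ᶠ[𝓝 s] fun t => ∑ k ∈ I, c k t * φ k x := by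
    filter_upwards [Ioo_mem_nhds hsT.1 hsT.2] with t ht
    exact hG.eq_sum t (Ioo_subset_Icc_self ht) x
  rw [hev.deriv_eq]
  exact (HasDerivAt.fun_sum fun k hk => (hs k hk
    (Icc_subset_uIcc (Ioo_subset_Icc_self hsT))).hasDerivAt.mul_const (φ k x)).deriv

lemma memLp_top_apply {t : ℝ} (hG : IsSeparated T ν I c φ G) (ht : t ∈ Icc 0 T) :
    MemLp (G t) ⊤ ν := by
  rw [funext (hG.eq_sum t ht)]
  exact memLp_finsetSum I fun k hk => (hG.memLp_basis k hk).const_mul (c k t)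

variable [IsFiniteMeasure ν]

lemma memLp_top_uncurry (hG : IsSeparated T ν I c φ G) (hT : 0 ≤ T) :
    MemLp (Function.uncurry G) ⊤ ((volume.restrict (Ioc 0 T)).prod ν) := by
  have hsum : MemLp (fun z : ℝ × X => ∑ k ∈ I, c k z.1 * φ k z.2) ⊤
      ((volume.restrict (Ioc 0 T)).prod ν) :=
    memLp_finsetSum I fun k hk => ((hG.memLp_basis k hk).comp_snd _).mul
      ((memLp_top_of_absolutelyContinuousOnInterval hT (hG.coeff k hk)).comp_fst ν)
  refine hsum.ae_eq ?_
  filter_upwards [Measure.quasiMeasurePreserving_fst.ae (ae_restrict_mem measurableSet_Ioc)]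
    with z hz using (hG.eq_sum z.1 (Ioc_subset_Icc_self hz) z.2).symm

lemma integrable_substantialIntegral (hG : IsSeparated T ν I c φ G) (hT : 0 ≤ T) (hγ1 : γ < 1)
    (hq : Integrable q ν) (hq0 : ∀ᵐ x ∂ν, 0 ≤ (q x).re) :
    Integrable (fun z : ℝ × X => substantialIntegral γ (q z.2) (fun t => G t z.2) z.1)
      ((volume.restrict (Ioc 0 T)).prod ν) := by
  have hterm : ∀ k ∈ I, Integrable (fun z : (X × ℝ) × ℝ => singularKernel γ (z.1.2 - z.2) •
      (Complex.exp (q z.1.1 * ((z.2 - z.1.2 : ℝ) : ℂ)) *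
        (deriv (c k) z.2 * φ k z.1.1 + c k z.2 * (q z.1.1 * φ k z.1.1))))
      ((ν.prod (volume.restrict (Ioc 0 T))).prod (volume.restrict (Ioc 0 T))) := fun k hk => by
    have hderiv : IntegrableOn (deriv (c k)) (Ioc 0 T) :=
      (intervalIntegrable_iff_integrableOn_Ioc_of_le hT).1
        (intervalIntegrable_deriv_of_absolutelyContinuousOnInterval (hG.coeff k hk))
    have hcoeff : IntegrableOn (c k) (Ioc 0 T) :=
      (memLp_top_of_absolutelyContinuousOnInterval hT (hG.coeff k hk)).integrable le_top
    refine ((integrable_singularKernel_smul_exp_mul hγ1 hq.1 hq0 hderiv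
      ((hG.memLp_basis k hk).integrable le_top)).add (integrable_singularKernel_smul_exp_mul hγ1
        hq.1 hq0 hcoeff (hq.mul_of_top_left (hG.memLp_basis k hk)))).congr
      (Eventually.of_forall fun z => ?_)
    simp only [Pi.add_apply, Pi.mul_apply, mul_add, smul_add]
  refine (integrable_finsetSum I hterm).integral_prod_left.swap.congr ?_
  filter_upwards [Measure.quasiMeasurePreserving_fst.ae (ae_restrict_mem measurableSet_Ioc)]
    with z hz
  rw [substantialIntegral_eq_setIntegral (Ioc_subset_Icc_self hz) (q z.2)
    (e := fun s => ∑ k ∈ I, (deriv (c k) s * φ k z.2 + c k s * (q z.2 * φ k z.2)))]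
  · simp only [Function.comp_apply, Prod.fst_swap, Prod.snd_swap, Finset.mul_sum, Finset.smul_sum]
  · filter_upwards [hG.ae_deriv_eq] with s hs hsT
    rw [hs hsT, hG.eq_sum s (Ioo_subset_Icc_self hsT), Finset.mul_sum, ← Finset.sum_add_distrib]
    exact Finset.sum_congr rfl fun k _ => by ring

lemma integrable_substantialIntegral_mul_conj (hG : IsSeparated T ν I c φ G) (hT : 0 ≤ T)
    (hγ1 : γ < 1) (hq : Integrable q ν) (hq0 : ∀ᵐ x ∂ν, 0 ≤ (q x).re) :
    Integrable (fun z : ℝ × X => substantialIntegral γ (q z.2) (fun t => G t z.2) z.1 *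
      conj (G z.1 z.2)) ((volume.restrict (Ioc 0 T)).prod ν) :=
  (hG.integrable_substantialIntegral hT hγ1 hq hq0).mul_of_top_left (hG.memLp_top_uncurry hT).star

lemma integral_substantialIntegral_mul_conj_ge (hG : IsSeparated τ ν I c φ G) (hτ : 0 ≤ τ)
    (hτT : τ ≤ T) (hγ : 0 ≤ γ) (hγ1 : γ < 1) (hq : Integrable q ν)
    (hq0 : ∀ᵐ x ∂ν, 0 ≤ (q x).re) :
    T ^ (-γ) / 2 * ((∫ t in Ioc 0 τ, ∫ x, ‖G t x‖ ^ 2 ∂ν) - T / (1 - γ) * ∫ x, ‖G 0 x‖ ^ 2 ∂ν) ≤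
      (∫ t in Ioc 0 τ, ∫ x, substantialIntegral γ (q x) (fun t => G t x) t *
        conj (G t x) ∂ν).re := by
  have hprod := hG.integrable_substantialIntegral_mul_conj hτ hγ1 hq hq0
  have hsq : Integrable (fun z : ℝ × X => ‖G z.1 z.2‖ ^ 2) ((volume.restrict (Ioc 0 τ)).prod ν) :=
    ((hG.memLp_top_uncurry hτ).mono_exponent le_top).integrable_norm_pow (p := 2) two_ne_zero
  have hsq0 : Integrable (fun x => ‖G 0 x‖ ^ 2) ν :=
    ((hG.memLp_top_apply ⟨le_rfl, hτ⟩).mono_exponent le_top).integrable_norm_pow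
      (p := 2) two_ne_zero
  have hpow : T ^ (1 - γ) = T * T ^ (-γ) := by
    rw [sub_eq_add_neg, Real.rpow_one_add' (hτ.trans hτT) (by linarith)]
  calc _ = ∫ x, T ^ (-γ) / 2 * ((∫ t in Ioc 0 τ, ‖G t x‖ ^ 2) - T / (1 - γ) * ‖G 0 x‖ ^ 2) ∂ν := by
        rw [integral_const_mul, integral_sub hsq.integral_prod_right (hsq0.const_mul _),
          integral_const_mul, integral_integral_swap hsq]
    _ ≤ ∫ x, (∫ t in Ioc 0 τ, (substantialIntegral γ (q x) (fun t => G t x) t *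
          conj (G t x)).re) ∂ν := by
        refine integral_mono_ae ((hsq.integral_prod_right.sub (hsq0.const_mul _)).const_mul _)
          hprod.re.integral_prod_right ?_
        filter_upwards [hq0] with x hx
        refine le_of_eq_of_le ?_ (integral_substantialIntegral_ge hγ hγ1 hτ hτT hx
          (hG.absolutelyContinuousOnInterval hτ x))
        rw [hpow]
        ring
    _ = _ := by
        rw [← integral_prod _ hprod]
        exact (integral_prod_symm _ hprod.re).symm.trans (integral_re hprod)

end IsSeparated

end Separated

section Energy

variable {X : Type*} [MeasurableSpace X] {ν : Measure X}

lemma re_mul_conj_le_of_pos {δ : ℝ} (hδ : 0 < δ) (u v : ℂ) :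
    (u * conj v).re ≤ δ * ‖v‖ ^ 2 + (4 * δ)⁻¹ * ‖u‖ ^ 2 := by
  have hsq : δ * ‖v‖ ^ 2 + (4 * δ)⁻¹ * ‖u‖ ^ 2 - ‖u‖ * ‖v‖ =
      (4 * δ)⁻¹ * (‖u‖ - 2 * δ * ‖v‖) ^ 2 := by
    field_simp
    ring
  have hnorm : (u * conj v).re ≤ ‖u‖ * ‖v‖ :=
    (Complex.re_le_norm _).trans_eq (by rw [norm_mul, RCLike.norm_conj])
  have : 0 ≤ (4 * δ)⁻¹ * (‖u‖ - 2 * δ * ‖v‖) ^ 2 := by positivity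
  linarith

lemma re_integral_mul_conj_le {f g : X → ℂ} (hf : MemLp f 2 ν) (hg : MemLp g 2 ν) {δ : ℝ}
    (hδ : 0 < δ) :
    (∫ x, f x * conj (g x) ∂ν).re ≤ δ * (∫ x, ‖g x‖ ^ 2 ∂ν) + (4 * δ)⁻¹ * ∫ x, ‖f x‖ ^ 2 ∂ν := by
  have hfg : Integrable (fun x => f x * conj (g x)) ν := hf.integrable_mul hg.star
  have hf2 := (hf.integrable_norm_pow (p := 2) two_ne_zero).const_mul (4 * δ)⁻¹
  have hg2 := (hg.integrable_norm_pow (p := 2) two_ne_zero).const_mul δ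
  rw [← integral_const_mul, ← integral_const_mul, ← integral_add hg2 hf2]
  exact (integral_re hfg).symm.trans_le
    (integral_mono hfg.re (hg2.add hf2) fun x => re_mul_conj_le_of_pos hδ (f x) (g x))

lemma integral_re_integral_prod {Y : Type*} [MeasurableSpace Y] {μ : Measure Y} [SFinite μ]
    [SFinite ν] {F : Y → X → ℂ} (hF : Integrable (Function.uncurry F) (μ.prod ν)) :
    ∫ t, (∫ x, F t x ∂ν).re ∂μ = (∫ z, F z.1 z.2 ∂(μ.prod ν)).re :=
  (integral_re hF.integral_prod_left).trans (congrArg Complex.re (integral_prod _ hF).symm)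

namespace IsSeparated

variable {ι : Type*} {I : Finset ι} {c : ι → ℝ → ℂ} {φ : ι → X → ℂ} {f G : ℝ → X → ℂ}
  {γ T τ κ : ℝ} {q : X → ℂ} {r : ℝ → ℝ} [IsFiniteMeasure ν]

lemma integrableOn_integral_norm_sq (hG : IsSeparated τ ν I c φ G) (hτ : 0 ≤ τ) :
    IntegrableOn (fun t => ∫ x, ‖G t x‖ ^ 2 ∂ν) (Ioc 0 τ) :=
  (((hG.memLp_top_uncurry hτ).mono_exponent le_top).integrable_norm_pow
    (p := 2) two_ne_zero).integral_prod_left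

lemma integrable_mul_conj (hG : IsSeparated τ ν I c φ G) (hτ : 0 ≤ τ)
    (hf : MemLp (Function.uncurry f) 2 ((volume.restrict (Ioc 0 τ)).prod ν)) :
    Integrable (Function.uncurry fun t x => f t x * conj (G t x))
      ((volume.restrict (Ioc 0 τ)).prod ν) :=
  hf.integrable_mul ((hG.memLp_top_uncurry hτ).mono_exponent (p := 2) le_top).star

lemma integral_re_integral_mul_conj_le (hG : IsSeparated τ ν I c φ G) (hτ : 0 ≤ τ)
    (hf : MemLp (Function.uncurry f) 2 ((volume.restrict (Ioc 0 τ)).prod ν)) {δ : ℝ}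
    (hδ : 0 < δ) :
    ∫ t in Ioc 0 τ, (∫ x, f t x * conj (G t x) ∂ν).re ≤
      δ * (∫ t in Ioc 0 τ, ∫ x, ‖G t x‖ ^ 2 ∂ν) +
        (4 * δ)⁻¹ * ∫ t in Ioc 0 τ, ∫ x, ‖f t x‖ ^ 2 ∂ν := by
  have hG2 := (hG.memLp_top_uncurry hτ).mono_exponent (p := 2) le_top
  rw [integral_re_integral_prod (hG.integrable_mul_conj hτ hf),
    integral_integral (hG2.integrable_norm_pow (p := 2) two_ne_zero),
    integral_integral (hf.integrable_norm_pow (p := 2) two_ne_zero)]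
  exact re_integral_mul_conj_le hf hG2 hδ

lemma integrableOn_of_energy_identity (hG : IsSeparated τ ν I c φ G) (hτ : 0 ≤ τ) (hγ1 : γ < 1)
    (hq : Integrable q ν) (hq0 : ∀ᵐ x ∂ν, 0 ≤ (q x).re)
    (hf : MemLp (Function.uncurry f) 2 ((volume.restrict (Ioc 0 τ)).prod ν))
    (hr : ∀ᵐ t ∂(volume.restrict (Ioc 0 τ)),
      κ * (∫ x, substantialIntegral γ (q x) (fun t => G t x) t * conj (G t x) ∂ν).re + r t =
        (∫ x, f t x * conj (G t x) ∂ν).re) :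
    IntegrableOn r (Ioc 0 τ) := by
  have hwork := (hG.integrable_substantialIntegral_mul_conj hτ hγ1 hq hq0).integral_prod_left.re
  refine ((hG.integrable_mul_conj hτ hf).integral_prod_left.re.sub (hwork.const_mul κ)).congr ?_
  filter_upwards [hr] with t ht
  exact sub_eq_of_eq_add' ht.symm

lemma energy_le (hG : IsSeparated τ ν I c φ G) (hτ : 0 ≤ τ) (hτT : τ ≤ T) (hT : 0 < T)
    (hγ : 0 ≤ γ) (hγ1 : γ < 1) (hκ : 0 < κ) (hq : Integrable q ν) (hq0 : ∀ᵐ x ∂ν, 0 ≤ (q x).re)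
    (hf : MemLp (Function.uncurry f) 2 ((volume.restrict (Ioc 0 τ)).prod ν))
    (hr : ∀ᵐ t ∂(volume.restrict (Ioc 0 τ)),
      κ * (∫ x, substantialIntegral γ (q x) (fun t => G t x) t * conj (G t x) ∂ν).re + r t =
        (∫ x, f t x * conj (G t x) ∂ν).re) :
    κ * T ^ (-γ) / 4 * (∫ t in Ioc 0 τ, ∫ x, ‖G t x‖ ^ 2 ∂ν) + (∫ t in Ioc 0 τ, r t) ≤
      κ * T ^ (-γ) / 2 * (T / (1 - γ)) * (∫ x, ‖G 0 x‖ ^ 2 ∂ν) +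
        (κ * T ^ (-γ))⁻¹ * ∫ t in Ioc 0 τ, ∫ x, ‖f t x‖ ^ 2 ∂ν := by
  have hprod : IntegrableOn (fun t => ∫ x, substantialIntegral γ (q x) (fun t => G t x) t *
      conj (G t x) ∂ν) (Ioc 0 τ) :=
    (hG.integrable_substantialIntegral_mul_conj hτ hγ1 hq hq0).integral_prod_left
  have hre : ∫ t in Ioc 0 τ, (∫ x, substantialIntegral γ (q x) (fun t => G t x) t *
      conj (G t x) ∂ν).re = (∫ t in Ioc 0 τ, ∫ x, substantialIntegral γ (q x) (fun t => G t x) t *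
      conj (G t x) ∂ν).re := integral_re hprod
  have hprod_re : IntegrableOn (fun t => (∫ x, substantialIntegral γ (q x) (fun t => G t x) t *
      conj (G t x) ∂ν).re) (Ioc 0 τ) := hprod.re
  have hwork := mul_le_mul_of_nonneg_left
    (hG.integral_substantialIntegral_mul_conj_ge hτ hτT hγ hγ1 hq hq0) hκ.le
  have hsource := hG.integral_re_integral_mul_conj_le hτ hf (δ := κ * T ^ (-γ) / 4) (by positivity)
  rw [← integral_congr_ae hr, integral_add (hprod_re.const_mul κ)
    (hG.integrableOn_of_energy_identity hτ hγ1 hq hq0 hf hr), integral_const_mul, hre,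
    mul_div_cancel₀ _ (four_ne_zero' ℝ)] at hsource
  linarith

end IsSeparated

end Energy

lemma caputoSubstantial_eq (γ : ℝ) (p : ℂ) (U : ℝ → ℝ) (G : ℝ → ℝ → ℂ) (t x : ℝ) :
    caputoSubstantial γ p U G t x =
      ((Real.Gamma (1 - γ))⁻¹ : ℝ) * substantialIntegral γ (p * U x) (fun τ => G τ x) t := by
  rw [caputoSubstantial, substantialIntegral, Complex.real_smul]
  ring

lemma l2Norm_sq (a b : ℝ) (u : ℝ → ℂ) : l2Norm a b u ^ 2 = ∫ x in Ioo a b, ‖u x‖ ^ 2 :=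
  Real.sq_sqrt (integral_nonneg fun _ => by positivity)

lemma memLp_top_scaling {a b : ℝ} {d J k : ℕ} (hab : a < b) (hd : 2 ≤ d)
    (hk : k ∈ scalingIndex d J) : MemLp (scaling a b d J k) ⊤ (volume.restrict (Ioo a b)) := by
  obtain ⟨⟨C, hlip⟩, -⟩ := scaling_mem_lipschitzVanishingOn hab hd hk
  rw [← uIcc_of_le hab.le] at hlip
  rw [restrict_Ioo_eq_restrict_Ioc]
  exact memLp_top_of_absolutelyContinuousOnInterval hab.le hlip.absolutelyContinuousOnInterval

namespace IsSemiDiscreteSolution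

variable {a b α γ K T : ℝ} {d J : ℕ} {p : ℂ} {U : ℝ → ℝ} {f G : ℝ → ℝ → ℂ}

lemma exists_isSeparated (hG : IsSemiDiscreteSolution a b α γ K T d J p U f G) (hab : a < b)
    (hd : 2 ≤ d) : ∃ c, IsSeparated T (volume.restrict (Ioo a b)) (scalingIndex d J) c
      (scaling a b d J) G := by
  obtain ⟨c, hc, hsum⟩ := hG.trial
  exact ⟨c, hc, fun _ => memLp_top_scaling hab hd, hsum⟩

lemma mem_splineSpace (hG : IsSemiDiscreteSolution a b α γ K T d J p U f G) {t : ℝ}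
    (ht : t ∈ Icc 0 T) : G t ∈ splineSpace a b d J := by
  obtain ⟨c, -, hsum⟩ := hG.trial
  have hGt : G t = ∑ k ∈ scalingIndex d J, c k t • scaling a b d J k := by
    funext x
    simp [hsum t ht x]
  rw [hGt]
  exact Submodule.sum_mem _ fun k hk =>
    Submodule.smul_mem _ _ (Submodule.subset_span ⟨k, hk, rfl⟩)

lemma re_rieszForm_nonneg (hG : IsSemiDiscreteSolution a b α γ K T d J p U f G) (hab : a < b)
    (hα : 1 < α) (hα2 : α < 2) (hd : 2 ≤ d) {t : ℝ} (ht : t ∈ Icc 0 T) :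
    0 ≤ (rieszForm a b α (G t) (G t)).re :=
  re_rieszForm_self_nonneg hab.le hα hα2
    (splineSpace_le_lipschitzVanishingOn hab hd J (hG.mem_splineSpace ht))

lemma ae_energy_identity (hG : IsSemiDiscreteSolution a b α γ K T d J p U f G) {τ : ℝ}
    (hτ : τ ≤ T) : ∀ᵐ t ∂(volume.restrict (Ioc 0 τ)),
      (Real.Gamma (1 - γ))⁻¹ * (∫ x in Ioo a b,
          substantialIntegral γ (p * U x) (fun t => G t x) t * conj (G t x)).re +
        K * (rieszForm a b α (G t) (G t)).re = (∫ x in Ioo a b, f t x * conj (G t x)).re := by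
  have hweak := hG.weak
  rw [restrict_Ioo_eq_restrict_Ioc] at hweak
  filter_upwards [ae_restrict_of_ae_restrict_of_subset (Ioc_subset_Ioc_right hτ) hweak,
    ae_restrict_mem measurableSet_Ioc] with t ht htm
  have htest := congrArg Complex.re (ht (G t) (hG.mem_splineSpace ⟨htm.1.le, htm.2.trans hτ⟩))
  simp only [l2Inner, caputoSubstantial_eq, mul_assoc, integral_const_mul, Complex.add_re,
    Complex.re_ofReal_mul] at htest
  exact htest

lemma integrableOn_re_rieszForm (hG : IsSemiDiscreteSolution a b α γ K T d J p U f G)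
    (hab : a < b) (hd : 2 ≤ d) (hγ1 : γ < 1) (hU : IntegrableOn U (Ioo a b))
    (hpU : ∀ x ∈ Ioo a b, 0 ≤ (p * U x).re) {τ : ℝ} (hτ : τ ∈ Icc 0 T)
    (hf : MemLp (Function.uncurry f) 2
      ((volume.restrict (Ioc 0 τ)).prod (volume.restrict (Ioo a b)))) :
    IntegrableOn (fun t => K * (rieszForm a b α (G t) (G t)).re) (Ioc 0 τ) := by
  obtain ⟨c, hsep⟩ := hG.exists_isSeparated hab hd
  exact (hsep.mono hτ).integrableOn_of_energy_identity hτ.1 hγ1 (hU.ofReal.const_mul p)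
    ((ae_restrict_mem measurableSet_Ioo).mono hpU) hf (hG.ae_energy_identity hτ.2)

lemma integrableOn_l2Norm_sq (hG : IsSemiDiscreteSolution a b α γ K T d J p U f G)
    (hab : a < b) (hd : 2 ≤ d) {τ : ℝ} (hτ : τ ∈ Icc 0 T) :
    IntegrableOn (fun t => l2Norm a b (G t) ^ 2) (Ioc 0 τ) := by
  obtain ⟨c, hsep⟩ := hG.exists_isSeparated hab hd
  simpa only [l2Norm_sq] using (hsep.mono hτ).integrableOn_integral_norm_sq hτ.1

lemma energy_le (hG : IsSemiDiscreteSolution a b α γ K T d J p U f G)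
    (hab : a < b) (hd : 2 ≤ d) (hT : 0 < T) (hγ : 0 ≤ γ) (hγ1 : γ < 1)
    (hU : IntegrableOn U (Ioo a b)) (hpU : ∀ x ∈ Ioo a b, 0 ≤ (p * U x).re) {τ : ℝ}
    (hτ : τ ∈ Icc 0 T) (hf : MemLp (Function.uncurry f) 2
      ((volume.restrict (Ioc 0 τ)).prod (volume.restrict (Ioo a b)))) :
    (Real.Gamma (1 - γ))⁻¹ * T ^ (-γ) / 4 * (∫ t in Ioc 0 τ, l2Norm a b (G t) ^ 2) +
        (∫ t in Ioc 0 τ, K * (rieszForm a b α (G t) (G t)).re) ≤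
      (Real.Gamma (1 - γ))⁻¹ * T ^ (-γ) / 2 * (T / (1 - γ)) * l2Norm a b (G 0) ^ 2 +
        ((Real.Gamma (1 - γ))⁻¹ * T ^ (-γ))⁻¹ * ∫ t in Ioc 0 τ, l2Norm a b (f t) ^ 2 := by
  obtain ⟨c, hsep⟩ := hG.exists_isSeparated hab hd
  simpa only [l2Norm_sq] using (hsep.mono hτ).energy_le hτ.1 hτ.2 hT hγ hγ1
    (inv_pos.2 (Real.Gamma_pos_of_pos (by linarith))) (hU.ofReal.const_mul p)
    ((ae_restrict_mem measurableSet_Ioo).mono hpU) hf (hG.ae_energy_identity hτ.2)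

end IsSemiDiscreteSolution

lemma memLp_uncurry_restrict_Ioc {X : Type*} [MeasurableSpace X] {ν : Measure X} [SFinite ν]
    {f : ℝ → X → ℂ} {T τ : ℝ}
    (hf : MemLp (Function.uncurry f) 2 ((volume.restrict (Ioo 0 T)).prod ν)) (hτ : τ ≤ T) :
    MemLp (Function.uncurry f) 2 ((volume.restrict (Ioc 0 τ)).prod ν) := by
  rw [← restrict_Ioo_eq_restrict_Ioc]
  exact hf.mono_measure
    (Measure.prod_mono (Measure.restrict_mono (Ioo_subset_Ioo_right hτ) le_rfl) le_rfl)

lemma add_le_of_mul_add_le {A N Q R : ℝ} (hA : 0 < A) (hN : 0 ≤ N) (hQ : 0 ≤ Q)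
    (h : A * N + Q ≤ R) : N + Q ≤ (1 + A⁻¹) * R := by
  refine le_trans ?_ (mul_le_mul_of_nonneg_left h (by positivity))
  have hexpand : (1 + A⁻¹) * (A * N + Q) = N + Q + (A * N + A⁻¹ * Q) := by
    field_simp
    ring
  rw [hexpand]
  exact le_add_of_nonneg_right (by positivity)

lemma mul_sq_add_mul_le {B D M n₀ n F : ℝ} (hB : 0 ≤ B) (hD : 0 ≤ D) (hF : 0 ≤ F)
    (hn₀ : 0 ≤ n₀) (hn : n₀ ≤ M * n) :
    B * n₀ ^ 2 + D * F ≤ (B * M ^ 2 + D) * (n ^ 2 + F) := by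
  have hcross : 0 ≤ B * M ^ 2 * F + D * n ^ 2 := by positivity
  calc B * n₀ ^ 2 + D * F ≤ B * (M * n) ^ 2 + D * F := by gcongr
    _ ≤ (B * M ^ 2 + D) * (n ^ 2 + F) := by linarith

end FeynmanKac

theorem mainTheorem4 (a b α γ K T M : ℝ) (hab : a < b) (hα : 1 < α) (hα2 : α < 2)
    (hγ : 0 < γ) (hγ1 : γ < 1) (hK : 0 < K) (hT : 0 < T) :
    ∃ C : ℝ, 0 < C ∧
      ∀ (d J : ℕ), 2 ≤ d →
      ∀ (p : ℂ) (U : ℝ → ℝ), IntegrableOn U (Ioo a b) →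
        (∀ x ∈ Ioo a b, 0 ≤ (p * (U x : ℂ)).re) →
      ∀ (g : ℝ → ℂ), MemLp g 2 (volume.restrict (Ioo a b)) →
      ∀ (f : ℝ → ℝ → ℂ),
        MemLp (Function.uncurry f) 2
          ((volume.restrict (Ioo (0 : ℝ) T)).prod (volume.restrict (Ioo a b))) →
      ∀ (G : ℝ → ℝ → ℂ), FeynmanKac.IsSemiDiscreteSolution a b α γ K T d J p U f G →
        FeynmanKac.l2Norm a b (G 0) ≤ M * FeynmanKac.l2Norm a b g →
      ∀ t ∈ Icc (0 : ℝ) T,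
        IntervalIntegrable (fun s : ℝ => FeynmanKac.l2Norm a b (G s) ^ 2 +
          K * (FeynmanKac.rieszForm a b α (G s) (G s)).re) volume 0 t ∧
        (∫ s in (0 : ℝ)..t, (FeynmanKac.l2Norm a b (G s) ^ 2 +
            K * (FeynmanKac.rieszForm a b α (G s) (G s)).re)) ≤
          C * (FeynmanKac.l2Norm a b g ^ 2 +
            ∫ s in (0 : ℝ)..t, FeynmanKac.l2Norm a b (f s) ^ 2) := by
  set A : ℝ := (Real.Gamma (1 - γ))⁻¹ * T ^ (-γ)
  have hA : 0 < A :=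
    mul_pos (inv_pos.2 (Real.Gamma_pos_of_pos (by linarith))) (Real.rpow_pos_of_pos hT _)
  have hB : 0 < A / 2 * (T / (1 - γ)) := mul_pos (half_pos hA) (div_pos hT (by linarith))
  refine ⟨(1 + (A / 4)⁻¹) * (A / 2 * (T / (1 - γ)) * M ^ 2 + A⁻¹), by positivity, ?_⟩
  intro d J hd p U hU hpU g _ f hf G hG hGg t ht
  have hft := FeynmanKac.memLp_uncurry_restrict_Ioc hf ht.2
  have hN := hG.integrableOn_l2Norm_sq hab hd ht
  have hQ := hG.integrableOn_re_rieszForm hab hd hγ1 hU hpU ht hft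
  refine ⟨(intervalIntegrable_iff_integrableOn_Ioc_of_le ht.1).2 (hN.add hQ), ?_⟩
  rw [intervalIntegral.integral_of_le ht.1, intervalIntegral.integral_of_le ht.1,
    integral_add hN hQ, mul_assoc (1 + (A / 4)⁻¹)]
  have hQ0 : 0 ≤ ∫ s in Ioc 0 t, K * (FeynmanKac.rieszForm a b α (G s) (G s)).re :=
    setIntegral_nonneg measurableSet_Ioc fun s hs => mul_nonneg hK.le
      (hG.re_rieszForm_nonneg hab hα hα2 hd ⟨hs.1.le, hs.2.trans ht.2⟩)
  exact FeynmanKac.add_le_of_mul_add_le (by positivity) (integral_nonneg fun _ => sq_nonneg _) hQ0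
    ((hG.energy_le hab hd hT hγ.le hγ1 hU hpU ht hft).trans (FeynmanKac.mul_sq_add_mul_le hB.le
      (inv_nonneg.2 hA.le) (integral_nonneg fun _ => sq_nonneg _) (Real.sqrt_nonneg _) hGg))
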